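/- Let $R>0$, $a>0$ and $p>1$ be real constants, and let $\mathcal B$ be one of the boundary operators at $x=0$: Dirichlet, $\mathcal Du(0)=u(0)$; Neumann, $\mathcal Nu(0)=-u'(0)$; or Robin, $\mathcal R_\beta u(0)=-u'(0)+\beta u(0)$ with $\beta\in\mathbb R$ of any sign. For $\lambda\in\mathbb R$ consider the singular problem $$-u''=\lambda u-a|u|^{p-1}u\ \text{ in }[0,R),\qquad \mathcal Bu(0)=0,\qquad \lim_{x\uparrow R}u(x)=+\infty. \tag{P}$$ A positive solution of (P) is a function $u\in\mathcal C^2([0,R);\mathbb R)$ (with one-sided derivatives at $0$) satisfying (P) and $u(x)>0$ for all $x\in(0,R)$. Then: (a) For every $\lambda\in\mathbb R$, problem (P) has a unique positive solution $L_\lambda$. (b) The map $\lambda\mapsto L_\lambda$ from $\mathbb R$ to $\mathcal C([0,R);\mathbb R)$, with the topology of uniform convergence on compact subsets of $[0,R)$, is differentiable. It is pointwise increasing: if $\lambda_1<\lambda_2$, then $L_{\lambda_1}(x)<L_{\lambda_2}(x)$ for all $x\in(0,R)$; moreover $L_{\lambda_1}(0)<L_{\lambda_2}(0)$ if $\mathcal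 B$ is Neumann or Robin, and $L_{\lambda_1}'(0)<L_{\lambda_2}'(0)$ if $\mathcal B=\mathcal D$. (c) As $\lambda\to+\infty$: if $\mathcal B$ is Neumann or Robin, $L_\lambda\to+\infty$ uniformly on compact subsets of $[0,R)$; if $\mathcal B=\mathcal D$, $L_\lambda\to+\infty$ uniformly on compact subsets of $(0,R)$, while $L_\lambda(0)=0$ for all $\lambda\in\mathbb R$. (d) As $\lambda\to-\infty$, $L_\lambda\to0$ uniformly on compact subsets of $[0,R)$. -/

import Mathlib

open Set Filter Topology

namespace LargeSol

/-- The boundary operators at `x = 0`: Dirichlet, Neumann, and Robin with a coefficient `β : ℝ` of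
arbitrary sign. -/
inductive BoundaryOp where
  | dirichlet : BoundaryOp
  | neumann : BoundaryOp
  | robin (β : ℝ) : BoundaryOp

/-- The value at `x = 0` of the boundary operator on a function `u` on `[0, R)`. The derivative at `0`
is the one-sided derivative within `[0, R)`, and the exterior normal derivative is `-u'(0)`. -/
noncomputable def BoundaryOp.value (B : BoundaryOp) (R : ℝ) (u : ℝ → ℝ) : ℝ :=
  match B with
  | .dirichlet => u 0
  | .neumann => -derivWithin u (Ico 0 R) 0
  | .robin β => -derivWithin u (Ico 0 R) 0 + β * u 0

/-- `u` (only its values on `[0, R)` matter) is a positive solution, of class `C²` on `[0, R)`, of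
`-u'' = lam u - a |u|^(p-1) u` in `[0, R)`, `B u(0) = 0`, `u(R) = +∞`.
Positive means positive in the open interval `(0, R)`. -/
structure IsPositiveSolution (B : BoundaryOp) (R a p lam : ℝ) (u : ℝ → ℝ) : Prop where
  contDiffOn : ContDiffOn ℝ 2 u (Ico 0 R)
  equation : ∀ x ∈ Ico 0 R,
    -derivWithin (derivWithin u (Ico 0 R)) (Ico 0 R) x = lam * u x - a * (|u x| ^ (p - 1) * u x)
  boundary : B.value R u = 0
  blowup : Tendsto u (𝓝[<] R) atTop
  pos : ∀ x ∈ Ioo 0 R, 0 < u x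

/-- Differentiability at every `lam : ℝ` of `lam ↦ L lam` as a map from `ℝ` to `C([0, R); ℝ)` with its
usual topology, that of uniform convergence on compact subsets of `[0, R)`: the difference quotients
converge in that topology to a continuous function `D` on `[0, R)`. -/
def DifferentiableIntoC (R : ℝ) (L : ℝ → ℝ → ℝ) : Prop :=
  ∀ lam : ℝ, ∃ D : ℝ → ℝ, ContinuousOn D (Ico 0 R) ∧
    ∀ K : Set ℝ, IsCompact K → K ⊆ Ico 0 R →
      TendstoUniformlyOn (fun μ x => (L μ x - L lam x) / (μ - lam)) D (𝓝[≠] lam) K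

/-- `L lam → +∞` as `lam → +∞`, uniformly on compact subsets of `S`. -/
def TendsToInftyOnCompacts (L : ℝ → ℝ → ℝ) (S : Set ℝ) : Prop :=
  ∀ K : Set ℝ, IsCompact K → K ⊆ S → ∀ M : ℝ, ∀ᶠ lam in atTop, ∀ x ∈ K, M < L lam x

end LargeSol

/-!
# Large solutions of `-u'' = lam u - a |u| ^ (p - 1) u` on `[0, R)`

Everything rests on one maximum principle, `HasDerivs.nonpos_of_wronskian`. For a solution `u > 0`
the quotient `u'' / u = a u ^ (p - 1) - lam` increases with `u`, so the Wronskian of two solutions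
increases wherever the first exceeds the second. Both satisfy the same homogeneous boundary
condition, so the Wronskian vanishes at `0`. Hence, where the first is larger, the quotient of the
two solutions is larger than `1` and keeps increasing up to `R`. On the other hand all large
solutions are asymptotically equal at `R`, whatever the value of `lam`
(`LargeSolution.tendsto_div`): by conservation of energy `u ^ (-(p - 1) / 2)` vanishes at `R` with a
slope that depends only on `a` and `p`. The two facts are incompatible, which gives uniqueness and
monotonicity in `lam`.

The same comparison against explicit functions gives the behavior for `lam → ±∞`: the subsolutions
`M exp (|β| x)` and `M sin (π x / R)` for `lam → +∞`, and a sum of two small exponentials as a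
supersolution for `lam → -∞`.

For differentiability, difference quotients in `lam` satisfy the linearized equation up to small
errors. The linearized operator admits a strict supersolution comparable to the solution itself
(`LargeSolution.exists_isBarrier`), because `p > 1`. Comparison with it bounds the quotients, and then
shows that they form a Cauchy family relative to the size of the solution.

Existence is by shooting along the line of initial data admitted by the boundary operator
(`exists_largeSolution`). All solutions that exist on `[0, R]` lie below an explicit supersolution
that blows up at `R`, so the supremum of their initial data is finite, and the solution with this
data exists on `[0, R)`. If it were bounded, it and its neighbors would extend to `[0, R]`; so it is
unbounded and, being convex up to a quadratic polynomial, tends to `+∞`.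
-/

namespace LargeSol

/-! ### The maximum principle -/

/-- `u` is twice differentiable on `[0, R)`, one-sidedly at `0`, with first and second derivatives
`u₁` and `u₂`. -/
structure HasDerivs (R : ℝ) (u u₁ u₂ : ℝ → ℝ) : Prop where
  fst : ∀ x ∈ Ico 0 R, HasDerivWithinAt u (u₁ x) (Ico 0 R) x
  snd : ∀ x ∈ Ico 0 R, HasDerivWithinAt u₁ (u₂ x) (Ico 0 R) x

namespace HasDerivs

variable {R : ℝ} {u u₁ u₂ v v₁ v₂ : ℝ → ℝ}

theorem continuousOn (h : HasDerivs R u u₁ u₂) : ContinuousOn u (Ico 0 R) :=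
  fun x hx => (h.fst x hx).continuousWithinAt

theorem continuousOn_fst (h : HasDerivs R u u₁ u₂) : ContinuousOn u₁ (Ico 0 R) :=
  fun x hx => (h.snd x hx).continuousWithinAt

theorem hasDerivAt (h : HasDerivs R u u₁ u₂) {x : ℝ} (hx : x ∈ Ioo 0 R) :
    HasDerivAt u (u₁ x) x :=
  (h.fst x (Ioo_subset_Ico_self hx)).hasDerivAt (Ico_mem_nhds hx.1 hx.2)

theorem hasDerivAt_fst (h : HasDerivs R u u₁ u₂) {x : ℝ} (hx : x ∈ Ioo 0 R) :
    HasDerivAt u₁ (u₂ x) x :=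
  (h.snd x (Ioo_subset_Ico_self hx)).hasDerivAt (Ico_mem_nhds hx.1 hx.2)

theorem sub (hu : HasDerivs R u u₁ u₂) (hv : HasDerivs R v v₁ v₂) :
    HasDerivs R (fun x => u x - v x) (fun x => u₁ x - v₁ x) (fun x => u₂ x - v₂ x) :=
  ⟨fun x hx => (hu.fst x hx).sub (hv.fst x hx), fun x hx => (hu.snd x hx).sub (hv.snd x hx)⟩

theorem const_mul (c : ℝ) (hu : HasDerivs R u u₁ u₂) :
    HasDerivs R (fun x => c * u x) (fun x => c * u₁ x) (fun x => c * u₂ x) :=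
  ⟨fun x hx => (hu.fst x hx).const_mul c, fun x hx => (hu.snd x hx).const_mul c⟩

theorem mono {b : ℝ} (hb : b ≤ R) (hu : HasDerivs R u u₁ u₂) : HasDerivs b u u₁ u₂ :=
  ⟨fun x hx => (hu.fst x ⟨hx.1, hx.2.trans_le hb⟩).mono (Ico_subset_Ico_right hb),
    fun x hx => (hu.snd x ⟨hx.1, hx.2.trans_le hb⟩).mono (Ico_subset_Ico_right hb)⟩

theorem of_hasDerivAt (h₁ : ∀ x ∈ Ico 0 R, HasDerivAt u (u₁ x) x)
    (h₂ : ∀ x ∈ Ico 0 R, HasDerivAt u₁ (u₂ x) x) : HasDerivs R u u₁ u₂ :=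
  ⟨fun x hx => (h₁ x hx).hasDerivWithinAt, fun x hx => (h₂ x hx).hasDerivWithinAt⟩

/-- The derivative of the Wronskian `u' v - u v'` is `u'' v - u v''`. -/
theorem wronskian (hu : HasDerivs R u u₁ u₂) (hv : HasDerivs R v v₁ v₂) {x : ℝ}
    (hx : x ∈ Ioo 0 R) :
    HasDerivAt (fun y => u₁ y * v y - u y * v₁ y) (u₂ x * v x - u x * v₂ x) x := by
  have h := ((hu.hasDerivAt_fst hx).mul (hv.hasDerivAt hx)).sub
    ((hu.hasDerivAt hx).mul (hv.hasDerivAt_fst hx))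
  convert! h using 1
  ring

theorem wronskian_continuousOn (hu : HasDerivs R u u₁ u₂) (hv : HasDerivs R v v₁ v₂) :
    ContinuousOn (fun y => u₁ y * v y - u y * v₁ y) (Ico 0 R) :=
  (hu.continuousOn_fst.mul hv.continuousOn).sub (hu.continuousOn.mul hv.continuousOn_fst)

theorem wronskian_monotoneOn (hu : HasDerivs R u u₁ u₂) (hv : HasDerivs R v v₁ v₂) {α c : ℝ}
    (hα : 0 ≤ α) (hc : c < R) (h : ∀ x ∈ Ioo α c, u x * v₂ x ≤ u₂ x * v x) :
    MonotoneOn (fun y => u₁ y * v y - u y * v₁ y) (Icc α c) := by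
  refine monotoneOn_of_hasDerivWithinAt_nonneg (convex_Icc α c)
    ((hu.wronskian_continuousOn hv).mono fun x hx => ⟨hα.trans hx.1, hx.2.trans_lt hc⟩)
    (f' := fun x => u₂ x * v x - u x * v₂ x) ?_ ?_
  · intro x hx
    rw [interior_Icc] at hx
    exact (hu.wronskian hv ⟨hα.trans_lt hx.1, hx.2.trans hc⟩).hasDerivWithinAt
  · intro x hx
    rw [interior_Icc] at hx
    linarith [h x hx]

/-- A quotient increases where the Wronskian is nonnegative. -/
theorem div_monotoneOn (hu : HasDerivs R u u₁ u₂) (hv : HasDerivs R v v₁ v₂)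
    (hpos : ∀ x ∈ Ioo 0 R, 0 < v x) {α c : ℝ} (hα : 0 < α) (hc : c < R)
    (h : ∀ x ∈ Ioo α c, 0 ≤ u₁ x * v x - u x * v₁ x) :
    MonotoneOn (fun y => u y / v y) (Icc α c) := by
  have hsub : Icc α c ⊆ Ioo 0 R := fun x hx => ⟨hα.trans_le hx.1, hx.2.trans_lt hc⟩
  refine monotoneOn_of_hasDerivWithinAt_nonneg (convex_Icc α c)
    (f' := fun x => (u₁ x * v x - u x * v₁ x) / v x ^ 2) ?_ ?_ ?_
  · intro x hx
    exact ((hu.hasDerivAt (hsub hx)).div (hv.hasDerivAt (hsub hx))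
      (hpos x (hsub hx)).ne').continuousAt.continuousWithinAt
  · intro x hx
    have hx' := hsub (interior_subset hx)
    exact ((hu.hasDerivAt hx').div (hv.hasDerivAt hx') (hpos x hx').ne').hasDerivWithinAt
  · intro x hx
    rw [interior_Icc] at hx
    exact div_nonneg (h x hx) (sq_nonneg _)

/-- **Maximum principle** on `[0, R)`. Let `Φ > 0` and suppose that the Wronskian of `z` and `Φ` is
nonnegative at `0` and nondecreasing wherever `z > 0`, so that `z / Φ` cannot start to decrease
while `z > 0`. If `z / Φ` has nonpositive upper limit at `R`, then `z ≤ 0`. -/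
theorem nonpos_of_wronskian {z z₁ z₂ Φ Φ₁ Φ₂ : ℝ → ℝ} (hz : HasDerivs R z z₁ z₂)
    (hΦ : HasDerivs R Φ Φ₁ Φ₂) (hpos : ∀ x ∈ Ioo 0 R, 0 < Φ x)
    (h0 : 0 ≤ z₁ 0 * Φ 0 - z 0 * Φ₁ 0)
    (hW : ∀ x ∈ Ioo 0 R, 0 < z x → z x * Φ₂ x ≤ z₂ x * Φ x)
    (hR : ∀ ε > 0, ∀ᶠ x in 𝓝[<] R, z x ≤ ε * Φ x) : ∀ x ∈ Ioo 0 R, z x ≤ 0 := by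
  intro x₀ hx₀
  by_contra! hzx₀
  -- `α` is the left end of the component of `{z > 0}` that contains `x₀`.
  obtain ⟨α, hα0, hαx, hαW, hαz⟩ : ∃ α, 0 ≤ α ∧ α < x₀ ∧ 0 ≤ z₁ α * Φ α - z α * Φ₁ α ∧
      ∀ x ∈ Ioc α x₀, 0 < z x := by
    have hsub : Icc 0 x₀ ⊆ Ico 0 R := fun x hx => ⟨hx.1, hx.2.trans_lt hx₀.2⟩
    have hcont : ContinuousOn z (Icc 0 x₀) := hz.continuousOn.mono hsub
    have hS : IsCompact ({0} ∪ (Icc 0 x₀ ∩ z ⁻¹' Iic 0)) :=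
      isCompact_singleton.union
        (isCompact_Icc.of_isClosed_subset (hcont.preimage_isClosed_of_isClosed isClosed_Icc
          isClosed_Iic) inter_subset_left)
    obtain ⟨α, hαS, hαmax⟩ := hS.exists_isGreatest ⟨0, Or.inl rfl⟩
    have hα0 : 0 ≤ α := by
      rcases hαS with h | h
      · exact (mem_singleton_iff.1 h).ge
      · exact h.1.1
    have hαx : α < x₀ := by
      rcases hαS with h | h
      · rw [mem_singleton_iff.1 h]; exact hx₀.1
      · refine lt_of_le_of_ne h.1.2 fun h' => ?_
        have := h.2
        rw [h'] at this
        exact absurd hzx₀ (not_lt.2 this)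
    have hαz : ∀ x ∈ Ioc α x₀, 0 < z x := by
      intro x hx
      by_contra! hzx
      exact absurd (hαmax (Or.inr ⟨⟨hα0.trans hx.1.le, hx.2⟩, hzx⟩)) (not_le.2 hx.1)
    refine ⟨α, hα0, hαx, ?_, hαz⟩
    rcases hα0.eq_or_lt with h | hαpos
    · rw [← h]; exact h0
    have hαR : α ∈ Ioo 0 R := ⟨hαpos, hαx.trans hx₀.2⟩
    have hzα : z α ≤ 0 := by
      rcases hαS with h | h
      · exact absurd (mem_singleton_iff.1 h) hαpos.ne'
      · exact h.2
    have hright : ∀ᶠ x in 𝓝[>] α, 0 < z x := by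
      filter_upwards [Ioc_mem_nhdsGT hαx] with x hx using hαz x hx
    have hzα' : 0 ≤ z α := ge_of_tendsto
      ((hz.hasDerivAt hαR).continuousAt.continuousWithinAt (s := Ioi α))
      (hright.mono fun x hx => hx.le)
    have hzα0 : z α = 0 := le_antisymm hzα hzα'
    have hz1 : 0 ≤ z₁ α := by
      refine ge_of_tendsto ((hasDerivWithinAt_iff_tendsto_slope' self_notMem_Ioi).1
        ((hz.hasDerivAt hαR).hasDerivWithinAt (s := Ioi α))) ?_
      filter_upwards [hright, self_mem_nhdsWithin] with x hx hxα
      rw [slope_def_field, hzα0, sub_zero]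
      exact div_nonneg hx.le (sub_nonneg.2 (le_of_lt hxα))
    rw [hzα0, zero_mul, sub_zero]
    exact mul_nonneg hz1 (hpos α hαR).le
  -- As long as `z > 0`, the quotient `z / Φ` is nondecreasing.
  have key : ∀ c, x₀ ≤ c → c < R → (∀ x ∈ Ioo α c, 0 < z x) → z x₀ / Φ x₀ ≤ z c / Φ c := by
    intro c hc hcR hzc
    have hWm := hz.wronskian_monotoneOn hΦ hα0 hcR fun x hx =>
      hW x ⟨hα0.trans_lt hx.1, hx.2.trans hcR⟩ (hzc x hx)
    refine hz.div_monotoneOn hΦ hpos hx₀.1 hcR (fun x hx => ?_) (left_mem_Icc.2 hc)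
      (right_mem_Icc.2 hc) hc
    exact hαW.trans (hWm (left_mem_Icc.2 (hαx.trans_le hc).le)
      ⟨(hαx.trans hx.1).le, hx.2.le⟩ (hαx.trans hx.1).le)
  have hy : 0 < z x₀ / Φ x₀ := div_pos hzx₀ (hpos x₀ hx₀)
  have hright : ∀ x, x₀ ≤ x → x < R → 0 < z x := by
    intro c hc hcR
    by_contra! hzc
    have hsub : Icc x₀ c ⊆ Ico 0 R := fun x hx => ⟨hx₀.1.le.trans hx.1, hx.2.trans_lt hcR⟩
    have hT : IsCompact (Icc x₀ c ∩ z ⁻¹' Iic 0) :=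
      isCompact_Icc.of_isClosed_subset ((hz.continuousOn.mono hsub).preimage_isClosed_of_isClosed
          isClosed_Icc isClosed_Iic) inter_subset_left
    obtain ⟨ω, hωT, hωmin⟩ := hT.exists_isLeast ⟨c, ⟨hc, le_rfl⟩, hzc⟩
    have hωR : ω < R := hωT.1.2.trans_lt hcR
    have := key ω hωT.1.1 hωR fun x hx => by
      rcases le_or_gt x x₀ with h | h
      · exact hαz x ⟨hx.1, h⟩
      · by_contra! hzx
        exact absurd (hωmin ⟨⟨h.le, hx.2.le.trans hωT.1.2⟩, hzx⟩) (not_le.2 hx.2)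
    have h2 : z ω / Φ ω ≤ 0 :=
      div_nonpos_of_nonpos_of_nonneg hωT.2 (hpos ω ⟨hx₀.1.trans_le hωT.1.1, hωR⟩).le
    linarith
  obtain ⟨x, hx, hxR⟩ := ((hR _ (half_pos hy)).and (Ioo_mem_nhdsLT hx₀.2)).exists
  have hΦx := hpos x ⟨hx₀.1.trans hxR.1, hxR.2⟩
  have h1 := key x hxR.1.le hxR.2 fun y hy => by
    rcases le_or_gt y x₀ with h | h
    · exact hαz y ⟨hy.1, h⟩
    · exact hright y h.le (hy.2.trans hxR.2)
  have h2 : z x / Φ x ≤ z x₀ / Φ x₀ / 2 := (div_le_iff₀ hΦx).2 hx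
  linarith

end HasDerivs

end LargeSol

namespace LargeSol

/-! ### Large solutions and their blow-up rate -/

/-- The direction in the `(u 0, u' 0)`-plane of the line of initial data admitted by `B`. -/
def BoundaryOp.dir (B : BoundaryOp) : ℝ × ℝ :=
  match B with
  | .dirichlet => (0, 1)
  | .neumann => (1, 0)
  | .robin β => (1, β)

theorem BoundaryOp.dir_fst_eq_one {B : BoundaryOp} (hB : B ≠ .dirichlet) : B.dir.1 = 1 := by
  cases B <;> simp_all [BoundaryOp.dir]

theorem BoundaryOp.value_eq_zero_iff (B : BoundaryOp) (R : ℝ) (u : ℝ → ℝ) :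
    B.value R u = 0 ↔ u 0 * B.dir.2 = derivWithin u (Ico 0 R) 0 * B.dir.1 := by
  cases B <;> simp only [BoundaryOp.value, BoundaryOp.dir] <;> constructor <;> intro h <;> linarith

/-- Data on the line admitted by `B` are multiples of its direction. -/
theorem BoundaryOp.exists_eq_mul_dir (B : BoundaryOp) {y w : ℝ} (h : y * B.dir.2 = w * B.dir.1) :
    ∃ t, y = t * B.dir.1 ∧ w = t * B.dir.2 := by
  cases B <;> simp only [BoundaryOp.dir] at h ⊢
  · exact ⟨w, by linarith, by linarith⟩
  · exact ⟨y, by linarith, by linarith⟩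
  · exact ⟨y, by linarith, by linarith⟩

/-- A positive solution of the singular problem together with its derivative `v`. The absolute value
in the equation is dropped, since `u ≥ 0`. -/
structure LargeSolution (B : BoundaryOp) (R a p lam : ℝ) (u v : ℝ → ℝ) : Prop where
  derivs : HasDerivs R u v (fun x => u x * (a * u x ^ (p - 1) - lam))
  boundary : u 0 * B.dir.2 = v 0 * B.dir.1
  blowup : Tendsto u (𝓝[<] R) atTop
  pos : ∀ x ∈ Ioo 0 R, 0 < u x

theorem nonneg_of_nonneg_Ioo {R : ℝ} (hR : 0 < R) {u : ℝ → ℝ} (hc : ContinuousOn u (Ico 0 R))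
    (hpos : ∀ x ∈ Ioo 0 R, 0 ≤ u x) : ∀ x ∈ Ico 0 R, 0 ≤ u x := by
  intro x hx
  rcases hx.1.eq_or_lt with h | h
  · subst h
    have h1 : Tendsto u (𝓝[>] 0) (𝓝 (u 0)) :=
      ((hc 0 hx).mono_of_mem_nhdsWithin (Ico_mem_nhdsGT hR))
    refine ge_of_tendsto h1 ?_
    filter_upwards [Ioo_mem_nhdsGT hR] with y hy using hpos y hy
  · exact hpos x ⟨h, hx.2⟩

theorem IsPositiveSolution.largeSolution {B : BoundaryOp} {R a p lam : ℝ} (hR : 0 < R) {u : ℝ → ℝ}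
    (h : IsPositiveSolution B R a p lam u) :
    LargeSolution B R a p lam u (derivWithin u (Ico 0 R)) := by
  have huniq : UniqueDiffOn ℝ (Ico 0 R) := uniqueDiffOn_Ico 0 R
  have hnn := nonneg_of_nonneg_Ioo hR h.contDiffOn.continuousOn fun x hx => (h.pos x hx).le
  have h1 : ContDiffOn ℝ 1 (derivWithin u (Ico 0 R)) (Ico 0 R) :=
    h.contDiffOn.derivWithin huniq (by norm_num)
  refine ⟨⟨fun x hx => ?_, fun x hx => ?_⟩, (B.value_eq_zero_iff R u).1 h.boundary, h.blowup,
    h.pos⟩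
  · exact ((h.contDiffOn.differentiableOn (by norm_num)) x hx).hasDerivWithinAt
  · have h2 := ((h1.differentiableOn (by norm_num)) x hx).hasDerivWithinAt
    have h3 := h.equation x hx
    rw [abs_of_nonneg (hnn x hx)] at h3
    convert! h2 using 1
    linarith

namespace LargeSolution

variable {B : BoundaryOp} {R a p lam mu : ℝ} {u v u' v' : ℝ → ℝ}

theorem nonneg (h : LargeSolution B R a p lam u v) (hR : 0 < R) : ∀ x ∈ Ico 0 R, 0 ≤ u x :=
  nonneg_of_nonneg_Ioo hR h.derivs.continuousOn fun x hx => (h.pos x hx).le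

theorem isPositiveSolution (h : LargeSolution B R a p lam u v) (hR : 0 < R) (hp : 1 < p) :
    IsPositiveSolution B R a p lam u := by
  have huniq : UniqueDiffOn ℝ (Ico 0 R) := uniqueDiffOn_Ico 0 R
  have hnn := h.nonneg hR
  have hd1 : ∀ x ∈ Ico 0 R, derivWithin u (Ico 0 R) x = v x := fun x hx =>
    (h.derivs.fst x hx).derivWithin (huniq x hx)
  have hd2 : ∀ x ∈ Ico 0 R, derivWithin v (Ico 0 R) x = u x * (a * u x ^ (p - 1) - lam) :=
    fun x hx => (h.derivs.snd x hx).derivWithin (huniq x hx)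
  have hcont2 : ContinuousOn (fun x => u x * (a * u x ^ (p - 1) - lam)) (Ico 0 R) :=
    h.derivs.continuousOn.mul ((continuousOn_const.mul
      (h.derivs.continuousOn.rpow_const fun x _ => Or.inr (by linarith))).sub continuousOn_const)
  have hv1 : ContDiffOn ℝ 1 v (Ico 0 R) := by
    rw [show (1 : WithTop ℕ∞) = 0 + 1 from rfl, contDiffOn_succ_iff_derivWithin huniq]
    refine ⟨fun x hx => (h.derivs.snd x hx).differentiableWithinAt, by simp, ?_⟩
    rw [contDiffOn_zero]
    exact hcont2.congr hd2
  refine ⟨?_, fun x hx => ?_, ?_, h.blowup, h.pos⟩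
  · rw [show (2 : WithTop ℕ∞) = 1 + 1 from (one_add_one_eq_two).symm,
      contDiffOn_succ_iff_derivWithin huniq]
    exact ⟨fun x hx => (h.derivs.fst x hx).differentiableWithinAt, by simp, hv1.congr hd1⟩
  · rw [derivWithin_congr hd1 (hd1 x hx), hd2 x hx, abs_of_nonneg (hnn x hx)]
    ring
  · rw [B.value_eq_zero_iff, hd1 0 ⟨le_rfl, hR⟩]
    exact h.boundary

/-- By uniqueness for the initial value problem, the initial data of a large solution are a positive
multiple of the direction of `B`. -/
theorem exists_initial (h : LargeSolution B R a p lam u v) (hR : 0 < R) (hp : 1 < p) :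
    ∃ t, 0 < t ∧ u 0 = t * B.dir.1 ∧ v 0 = t * B.dir.2 := by
  have h00 : (0 : ℝ) ∈ Ico 0 R := ⟨le_rfl, hR⟩
  have hnt : ¬ (u 0 = 0 ∧ v 0 = 0) := by
    rintro ⟨hu0, hv0⟩
    have hsub : Icc 0 (R / 2) ⊆ Ico 0 R := fun x hx => ⟨hx.1, by linarith [hx.2]⟩
    have hcont : ContinuousOn (fun x => a * u x ^ (p - 1) - lam) (Icc 0 (R / 2)) :=
      ((continuousOn_const.mul (h.derivs.continuousOn.rpow_const fun x _ =>
        Or.inr (by linarith))).sub continuousOn_const).mono hsub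
    obtain ⟨K, hK⟩ := isCompact_Icc.exists_bound_of_continuousOn hcont
    have := eq_zero_of_abs_deriv_le_mul_abs_self_of_eq_zero_right
      (f := fun x => (u x, v x)) (f' := fun x => (v x, u x * (a * u x ^ (p - 1) - lam)))
      (K := max 1 K) (a := 0) (b := R / 2)
      ((h.derivs.continuousOn.prodMk h.derivs.continuousOn_fst).mono hsub)
      (fun x hx => by
        have hx' : x ∈ Ico 0 R := hsub (Ico_subset_Icc_self hx)
        have hm : Ico 0 R ∈ 𝓝[≥] x := by
          exact mem_of_superset (Ico_mem_nhdsGE hx'.2) (Ico_subset_Ico_left hx'.1)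
        exact ((h.derivs.fst x hx').mono_of_mem_nhdsWithin hm).prodMk
          ((h.derivs.snd x hx').mono_of_mem_nhdsWithin hm))
      (by simp [hu0, hv0])
      (fun x hx => by
        have hKx := hK x (Ico_subset_Icc_self hx)
        rw [Prod.norm_def, Prod.norm_def]
        have hn : 0 ≤ max ‖u x‖ ‖v x‖ := (norm_nonneg _).trans (le_max_left _ _)
        refine max_le ?_ ?_
        · calc ‖v x‖ ≤ 1 * max ‖u x‖ ‖v x‖ := by rw [one_mul]; exact le_max_right _ _
            _ ≤ _ := mul_le_mul_of_nonneg_right (le_max_left _ _) hn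
        · dsimp only
          rw [norm_mul, mul_comm]
          exact mul_le_mul (hKx.trans (le_max_right _ _)) (le_max_left _ _) (norm_nonneg _)
            (zero_le_one.trans (le_max_left _ _)))
    have h4 := this (R / 4) ⟨by linarith, by linarith⟩
    have h5 := h.pos (R / 4) ⟨by linarith, by linarith⟩
    simp only [Prod.mk_eq_zero] at h4
    exact h5.ne' h4.1
  obtain ⟨t, hu0, hv0⟩ := B.exists_eq_mul_dir h.boundary
  refine ⟨t, ?_, hu0, hv0⟩
  have ht : t ≠ 0 := by
    rintro rfl
    exact hnt ⟨by simpa using hu0, by simpa using hv0⟩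
  refine lt_of_le_of_ne ?_ ht.symm
  by_cases hB : B = .dirichlet
  · subst hB
    simp only [BoundaryOp.dir, mul_zero, mul_one] at hu0 hv0
    rw [← hv0]
    refine ge_of_tendsto ((hasDerivWithinAt_iff_tendsto_slope' self_notMem_Ioi).1
      ((h.derivs.fst 0 h00).mono_of_mem_nhdsWithin (Ico_mem_nhdsGT hR) :
        HasDerivWithinAt u (v 0) (Ioi 0) 0)) ?_
    filter_upwards [Ioo_mem_nhdsGT hR] with x hx
    rw [slope_def_field, hu0, sub_zero, sub_zero]
    exact div_nonneg (h.pos x hx).le hx.1.le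
  · rw [BoundaryOp.dir_fst_eq_one hB, mul_one] at hu0
    rw [← hu0]
    exact h.nonneg hR 0 h00

/-- Two large solutions have vanishing Wronskian at `0`. -/
theorem wronskian_zero (h : LargeSolution B R a p lam u v) (h' : LargeSolution B R a p mu u' v') :
    v 0 * u' 0 - u 0 * v' 0 = 0 := by
  obtain ⟨t, h1, h2⟩ := B.exists_eq_mul_dir h.boundary
  obtain ⟨s, h3, h4⟩ := B.exists_eq_mul_dir h'.boundary
  rw [h1, h2, h3, h4]; ring

theorem eventually_mem (hR : 0 < R) : ∀ᶠ x in 𝓝[<] R, x ∈ Ioo 0 R := Ioo_mem_nhdsLT hR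

/-- Near the blow-up point the solution is convex, hence increasing. -/
theorem eventually_deriv_pos (h : LargeSolution B R a p lam u v) (hR : 0 < R) (ha : 0 < a)
    (hp : 1 < p) : ∀ᶠ x in 𝓝[<] R, 0 < v x := by
  have h1 : Tendsto (fun x => a * u x ^ (p - 1)) (𝓝[<] R) atTop :=
    ((tendsto_rpow_atTop (by linarith : 0 < p - 1)).comp h.blowup).const_mul_atTop ha
  obtain ⟨c, hcR, hc⟩ := (mem_nhdsLT_iff_exists_Ioo_subset' hR).1
    ((h1.eventually_ge_atTop lam).and (eventually_mem hR))
  obtain ⟨x₀, hx₀⟩ := exists_between (mem_Iio.1 hcR)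
  have hx₀' := hc hx₀
  obtain ⟨x₁, hx₁u, hx₁⟩ := ((h.blowup.eventually_gt_atTop (u x₀)).and
    (Ioo_mem_nhdsLT hx₀.2)).exists
  have hsub : ∀ x ∈ Ico x₀ R, x ∈ Ioo 0 R := fun x hx => ⟨hx₀'.2.1.trans_le hx.1, hx.2⟩
  obtain ⟨ξ, hξ, hξv⟩ := exists_hasDerivAt_eq_slope u v hx₁.1
    (h.derivs.continuousOn.mono fun x hx =>
      Ioo_subset_Ico_self (hsub x ⟨hx.1, hx.2.trans_lt hx₁.2⟩))
    (fun x hx => h.derivs.hasDerivAt (hsub x ⟨hx.1.le, hx.2.trans hx₁.2⟩))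
  have hξpos : 0 < v ξ := by
    rw [hξv]; exact div_pos (sub_pos.2 hx₁u) (sub_pos.2 hx₁.1)
  have hmono : MonotoneOn v (Ico x₀ R) := by
    refine monotoneOn_of_hasDerivWithinAt_nonneg (convex_Ico x₀ R)
      (h.derivs.continuousOn_fst.mono fun x hx => Ioo_subset_Ico_self (hsub x hx))
      (f' := fun x => u x * (a * u x ^ (p - 1) - lam)) ?_ ?_
    · intro x hx
      exact (h.derivs.hasDerivAt_fst (hsub x (interior_subset hx))).hasDerivWithinAt
    · intro x hx
      have hx' := interior_subset hx
      exact mul_nonneg (h.pos x (hsub x hx')).le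
        (sub_nonneg.2 (hc ⟨hx₀.1.trans_le hx'.1, hx'.2⟩).1)
  filter_upwards [Ioo_mem_nhdsLT (hξ.2.trans hx₁.2)] with x hx
  exact hξpos.trans_le (hmono ⟨hξ.1.le, hξ.2.trans hx₁.2⟩ ⟨(hξ.1.trans hx.1).le, hx.2⟩ hx.1.le)

/-- Conservation of energy gives the growth rate of the derivative in terms of the solution, with a
constant that does not depend on `lam`. -/
theorem tendsto_deriv_div_rpow (h : LargeSolution B R a p lam u v) (hR : 0 < R) (ha : 0 < a)
    (hp : 1 < p) :
    Tendsto (fun x => v x / u x ^ ((p + 1) / 2)) (𝓝[<] R) (𝓝 (√(2 * a / (p + 1)))) := by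
  have hp1 : p + 1 ≠ 0 := by linarith
  obtain ⟨E, hE⟩ : ∃ E, ∀ x ∈ Ioo 0 R,
      v x ^ 2 - 2 * a / (p + 1) * u x ^ (p + 1) + lam * u x ^ 2 = E := by
    have hd : ∀ x ∈ Ioo 0 R, HasDerivAt
        (fun x => v x ^ 2 - 2 * a / (p + 1) * u x ^ (p + 1) + lam * u x ^ 2) 0 x := by
      intro x hx
      have hu := h.derivs.hasDerivAt hx
      have h1 := (((h.derivs.hasDerivAt_fst hx).pow 2).sub
        ((hu.rpow_const (p := p + 1) (Or.inl (h.pos x hx).ne')).const_mul (2 * a / (p + 1)))).add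
          ((hu.pow 2).const_mul lam)
      convert! h1 using 1
      have h2 : u x ^ (p + 1 - 1) = u x * u x ^ (p - 1) := by
        rw [show p + 1 - 1 = 1 + (p - 1) by ring, Real.rpow_add (h.pos x hx), Real.rpow_one]
      rw [h2]
      field_simp
      ring
    have hopen : IsOpen (Ioo 0 R) := isOpen_Ioo
    obtain ⟨E, hE⟩ := hopen.exists_is_const_of_deriv_eq_zero isPreconnected_Ioo
      (fun x hx => (hd x hx).differentiableAt.differentiableWithinAt)
      (fun x hx => (hd x hx).deriv)
    exact ⟨E, hE⟩
  have hsq : Tendsto (fun x => v x ^ 2 / u x ^ (p + 1)) (𝓝[<] R) (𝓝 (2 * a / (p + 1))) := by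
    have h1 : Tendsto (fun x => u x ^ (-(p - 1))) (𝓝[<] R) (𝓝 0) :=
      (tendsto_rpow_neg_atTop (by linarith : 0 < p - 1)).comp h.blowup
    have h2 : Tendsto (fun x => u x ^ (-(p + 1))) (𝓝[<] R) (𝓝 0) :=
      (tendsto_rpow_neg_atTop (by linarith : 0 < p + 1)).comp h.blowup
    have h3 : Tendsto (fun x => 2 * a / (p + 1) - lam * u x ^ (-(p - 1)) + E * u x ^ (-(p + 1)))
        (𝓝[<] R) (𝓝 (2 * a / (p + 1) - lam * 0 + E * 0)) :=
      (tendsto_const_nhds.sub (h1.const_mul lam)).add (h2.const_mul E)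
    simp only [mul_zero, sub_zero, add_zero] at h3
    refine h3.congr' ?_
    filter_upwards [eventually_mem hR] with x hx
    have hux := h.pos x hx
    have hpow := Real.rpow_pos_of_pos hux (p + 1)
    rw [eq_div_iff hpow.ne']
    have e1 : u x ^ (-(p - 1)) * u x ^ (p + 1) = u x ^ 2 := by
      rw [← Real.rpow_add hux, show -(p - 1) + (p + 1) = (2 : ℕ) by push_cast; ring,
        Real.rpow_natCast]
    have e2 : u x ^ (-(p + 1)) * u x ^ (p + 1) = 1 := by
      rw [← Real.rpow_add hux, neg_add_cancel, Real.rpow_zero]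
    linear_combination -hE x hx - lam * e1 + E * e2
  refine ((Real.continuous_sqrt.tendsto _).comp hsq).congr' ?_
  filter_upwards [eventually_mem hR, h.eventually_deriv_pos hR ha hp] with x hx hv
  have hux := h.pos x hx
  have e : u x ^ (p + 1) = (u x ^ ((p + 1) / 2)) ^ 2 := by
    rw [← Real.rpow_natCast, ← Real.rpow_mul hux.le]
    congr 1; push_cast; ring
  rw [Function.comp_apply, e, ← div_pow, Real.sqrt_sq]
  exact div_nonneg hv.le (Real.rpow_nonneg hux.le _)

/-- Any two large solutions are asymptotically equal at the blow-up point, also for different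
parameters: `u ^ (-(p - 1) / 2)` vanishes at `R` with a slope that does not depend on the
solution. -/
theorem tendsto_div (h : LargeSolution B R a p lam u v) (h' : LargeSolution B R a p mu u' v')
    (hR : 0 < R) (ha : 0 < a) (hp : 1 < p) : Tendsto (fun x => u x / u' x) (𝓝[<] R) (𝓝 1) := by
  set κ := √(2 * a / (p + 1)) with hκ
  have hκpos : 0 < κ := Real.sqrt_pos.2 (div_pos (by linarith) (by linarith))
  have key : ∀ {ν : ℝ} {w w₁ : ℝ → ℝ}, LargeSolution B R a p ν w w₁ →
      (∀ x ∈ Ioo 0 R, HasDerivAt (fun x => w x ^ (-((p - 1) / 2)))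
        (-((p - 1) / 2) * (w₁ x / w x ^ ((p + 1) / 2))) x) ∧
      Tendsto (fun x => w x ^ (-((p - 1) / 2))) (𝓝[<] R) (𝓝 0) ∧
      Tendsto (fun x => -((p - 1) / 2) * (w₁ x / w x ^ ((p + 1) / 2))) (𝓝[<] R)
        (𝓝 (-((p - 1) / 2) * κ)) := by
    intro ν w w₁ hw
    refine ⟨fun x hx => ?_, (tendsto_rpow_neg_atTop (by linarith)).comp hw.blowup,
      (hw.tendsto_deriv_div_rpow hR ha hp).const_mul _⟩
    have := (hw.derivs.hasDerivAt hx).rpow_const (p := -((p - 1) / 2)) (Or.inl (hw.pos x hx).ne')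
    convert! this using 1
    rw [show -((p - 1) / 2) - 1 = -((p + 1) / 2) by ring, Real.rpow_neg (hw.pos x hx).le]
    ring
  obtain ⟨d1, z1, t1⟩ := key h
  obtain ⟨d2, z2, t2⟩ := key h'
  have hne : -((p - 1) / 2) * κ ≠ 0 := (mul_neg_of_neg_of_pos (by linarith) hκpos).ne
  have hlim := HasDerivAt.lhopital_zero_nhdsLT
    ((eventually_mem hR).mono d1) ((eventually_mem hR).mono d2)
    (t2.eventually_ne hne) z1 z2 (t1.div t2 hne)
  rw [div_self hne] at hlim
  have hlim2 := hlim.rpow_const (p := -(2 / (p - 1))) (Or.inl one_ne_zero)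
  rw [Real.one_rpow] at hlim2
  refine hlim2.congr' ?_
  filter_upwards [eventually_mem hR] with x hx
  have hu := h.pos x hx
  have hu' := h'.pos x hx
  rw [← Real.div_rpow hu.le hu'.le, ← Real.rpow_mul (div_pos hu hu').le]
  have : -((p - 1) / 2) * -(2 / (p - 1)) = 1 := by
    field_simp [(by linarith : p - 1 ≠ 0)]
  rw [this, Real.rpow_one]

theorem eventually_le_mul (h : LargeSolution B R a p lam u v)
    (h' : LargeSolution B R a p mu u' v') (hR : 0 < R) (ha : 0 < a) (hp : 1 < p) {c : ℝ}
    (hc : 1 < c) : ∀ᶠ x in 𝓝[<] R, u x ≤ c * u' x := by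
  filter_upwards [(h.tendsto_div h' hR ha hp).eventually_lt_const hc, eventually_mem hR]
    with x hx hx'
  exact ((div_lt_iff₀ (h'.pos x hx')).1 hx).le

end LargeSolution

end LargeSol

namespace LargeSol

/-! ### Comparison, uniqueness and monotonicity -/

/-- Comparison of a subsolution `u` with a positive supersolution `w`. Since `a y ^ (p - 1) - lam`
increases with `y > 0`, the Wronskian of `u - w` and `w` increases where `u > w`. -/
theorem HasDerivs.le_of_sub_super {R a p lam : ℝ} {u u₁ u₂ w w₁ w₂ : ℝ → ℝ} (ha : 0 < a)
    (hp : 1 < p) (hu : HasDerivs R u u₁ u₂) (hw : HasDerivs R w w₁ w₂)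
    (hpos : ∀ x ∈ Ioo 0 R, 0 < w x) (h0 : 0 ≤ u₁ 0 * w 0 - u 0 * w₁ 0)
    (hsub : ∀ x ∈ Ioo 0 R, w x < u x → u x * (a * u x ^ (p - 1) - lam) ≤ u₂ x)
    (hsup : ∀ x ∈ Ioo 0 R, w x < u x → w₂ x ≤ w x * (a * w x ^ (p - 1) - lam))
    (hR : ∀ ε > 0, ∀ᶠ x in 𝓝[<] R, u x ≤ (1 + ε) * w x) : ∀ x ∈ Ioo 0 R, u x ≤ w x := by
  intro x hx
  refine sub_nonpos.1 ((hu.sub hw).nonpos_of_wronskian hw hpos ?_ ?_ ?_ x hx)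
  · linarith
  · intro y hy hlt
    have hlt' := sub_pos.1 hlt
    have hwy := hpos y hy
    have hmono : w y ^ (p - 1) ≤ u y ^ (p - 1) :=
      Real.rpow_le_rpow hwy.le hlt'.le (by linarith)
    have h1 := mul_le_mul_of_nonneg_left (hsup y hy hlt') (hwy.trans hlt').le
    have h2 := mul_le_mul_of_nonneg_right (hsub y hy hlt') hwy.le
    have h3 : u y * w y * (a * w y ^ (p - 1) - lam) ≤ u y * w y * (a * u y ^ (p - 1) - lam) :=
      mul_le_mul_of_nonneg_left (by linarith [mul_le_mul_of_nonneg_left hmono ha.le])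
        (mul_pos (hwy.trans hlt') hwy).le
    nlinarith [h1, h2, h3]
  · intro ε hε
    filter_upwards [hR ε hε] with y hy
    linarith

namespace LargeSolution

variable {B : BoundaryOp} {R a p lam mu : ℝ} {u v u' v' : ℝ → ℝ}

theorem le_of_le (h : LargeSolution B R a p lam u v) (h' : LargeSolution B R a p mu u' v')
    (hR : 0 < R) (ha : 0 < a) (hp : 1 < p) (hle : lam ≤ mu) : ∀ x ∈ Ico 0 R, u x ≤ u' x := by
  have hIoo : ∀ x ∈ Ioo 0 R, u x ≤ u' x := by
    refine h.derivs.le_of_sub_super ha hp h'.derivs h'.pos (h.wronskian_zero h').ge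
      (lam := lam) (fun x _ _ => le_rfl) (fun x hx _ => ?_)
      fun ε hε => h.eventually_le_mul h' hR ha hp (by linarith)
    exact mul_le_mul_of_nonneg_left (by linarith) (h'.pos x hx).le
  intro x hx
  exact sub_nonneg.1 (nonneg_of_nonneg_Ioo hR (h'.derivs.continuousOn.sub h.derivs.continuousOn)
    (fun y hy => sub_nonneg.2 (hIoo y hy)) x hx)

/-- The quotient of two large solutions extends continuously to `0`, for every boundary
operator. -/
theorem tendsto_div_zero (h : LargeSolution B R a p lam u v)
    (h' : LargeSolution B R a p mu u' v') (hR : 0 < R) {t s : ℝ} (hs : 0 < s)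
    (hu : u 0 = t * B.dir.1) (hv : v 0 = t * B.dir.2) (hu' : u' 0 = s * B.dir.1)
    (hv' : v' 0 = s * B.dir.2) : Tendsto (fun x => u x / u' x) (𝓝[>] 0) (𝓝 (t / s)) := by
  have h00 : (0 : ℝ) ∈ Ico 0 R := ⟨le_rfl, hR⟩
  have hm : Ico 0 R ∈ 𝓝[>] (0 : ℝ) := Ico_mem_nhdsGT hR
  by_cases hB : B = .dirichlet
  · subst hB
    simp only [BoundaryOp.dir, mul_zero, mul_one] at hu hv hu' hv'
    have key : ∀ {w w₁ w₂ : ℝ → ℝ}, HasDerivs R w w₁ w₂ → w 0 = 0 →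
        Tendsto (fun x => w x / x) (𝓝[>] 0) (𝓝 (w₁ 0)) := by
      intro w w₁ w₂ hw hw0
      have := (hasDerivWithinAt_iff_tendsto_slope' self_notMem_Ioi).1
        ((hw.fst 0 h00).mono_of_mem_nhdsWithin hm : HasDerivWithinAt w (w₁ 0) (Ioi 0) 0)
      refine this.congr fun x => ?_
      rw [slope_def_field, hw0, sub_zero, sub_zero]
    have h1 := (key h.derivs hu).div (key h'.derivs hu') (by rw [hv']; exact hs.ne')
    rw [hv, hv'] at h1
    refine h1.congr' ?_
    filter_upwards [self_mem_nhdsWithin] with x hx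
    exact div_div_div_cancel_right₀ (ne_of_gt hx) _ _
  · rw [BoundaryOp.dir_fst_eq_one hB, mul_one] at hu hu'
    have h1 : Tendsto u (𝓝[>] 0) (𝓝 (u 0)) :=
      (h.derivs.fst 0 h00).continuousWithinAt.mono_of_mem_nhdsWithin hm
    have h2 : Tendsto u' (𝓝[>] 0) (𝓝 (u' 0)) :=
      (h'.derivs.fst 0 h00).continuousWithinAt.mono_of_mem_nhdsWithin hm
    have := h1.div h2 (by rw [hu']; exact hs.ne')
    rwa [hu, hu'] at this

/-- The quotient of two large solutions is bounded. -/
theorem exists_le_mul (h : LargeSolution B R a p lam u v) (h' : LargeSolution B R a p mu u' v')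
    (hR : 0 < R) (ha : 0 < a) (hp : 1 < p) : ∃ K, 1 < K ∧ ∀ x ∈ Ioo 0 R, u x ≤ K * u' x := by
  obtain ⟨t, ht, hu, hv⟩ := h.exists_initial hR hp
  obtain ⟨s, hs, hu', hv'⟩ := h'.exists_initial hR hp
  have h0 := (h.tendsto_div_zero h' hR hs hu hv hu' hv').eventually_lt_const (lt_add_one _)
  have h1 := (h.tendsto_div h' hR ha hp).eventually_lt_const one_lt_two
  obtain ⟨c, hc0, hc⟩ := (mem_nhdsGT_iff_exists_Ioo_subset' hR).1 h0
  obtain ⟨d, hdR, hd⟩ := (mem_nhdsLT_iff_exists_Ioo_subset' hR).1 h1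
  rw [mem_Ioi] at hc0
  rw [mem_Iio] at hdR
  have hcont : ContinuousOn (fun x => u x / u' x) (Icc (min c (R / 2)) (max d (R / 2))) := by
    intro x hx
    have hx' : x ∈ Ioo 0 R := ⟨(lt_min hc0 (by linarith)).trans_le hx.1,
      hx.2.trans_lt (max_lt hdR (by linarith))⟩
    exact ((h.derivs.hasDerivAt hx').continuousAt.div (h'.derivs.hasDerivAt hx').continuousAt
      (h'.pos x hx').ne').continuousWithinAt
  obtain ⟨M, hM⟩ := isCompact_Icc.exists_bound_of_continuousOn hcont
  refine ⟨max (max (t / s + 1) 2) M, lt_max_of_lt_left (lt_max_of_lt_right one_lt_two),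
    fun x hx => (div_le_iff₀ (h'.pos x hx)).1 ?_⟩
  by_cases hxc : x < c
  · exact ((hc ⟨hx.1, hxc⟩ : _ < _).le.trans (le_max_left _ _)).trans (le_max_left _ _)
  by_cases hxd : d < x
  · exact ((hd ⟨hxd, hx.2⟩ : _ < _).le.trans (le_max_right _ _)).trans (le_max_left _ _)
  · exact (le_abs_self _).trans ((hM x ⟨(min_le_left _ _).trans (not_lt.1 hxc),
      (not_lt.1 hxd).trans (le_max_left _ _)⟩).trans (le_max_right _ _))

/-- For `lam < mu`, two large solutions cannot touch: at a contact point the Wronskian vanishes, and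
just to the right of it the quotient would be strictly decreasing. -/
theorem false_of_touch (h : LargeSolution B R a p lam u v) (h' : LargeSolution B R a p mu u' v')
    (hR : 0 < R) (ha : 0 < a) (hp : 1 < p) (hlt : lam < mu) {c : ℝ} (hc : c ∈ Ico 0 R)
    (huc : u' c = u c) (hW : v' c * u c - u' c * v c = 0)
    (hlim : Tendsto (fun x => u' x / u x) (𝓝[>] c) (𝓝 1)) : False := by
  have hm : Ico 0 R ∈ 𝓝[>] c :=
    mem_of_superset (Ico_mem_nhdsGT hc.2) (Ico_subset_Ico_left hc.1)
  have hpow : ∀ {w w₁ w₂ : ℝ → ℝ}, HasDerivs R w w₁ w₂ →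
      Tendsto (fun x => w x ^ (p - 1)) (𝓝[>] c) (𝓝 (w c ^ (p - 1))) := fun hw =>
    ((hw.fst c hc).continuousWithinAt.mono_of_mem_nhdsWithin hm).tendsto.rpow_const
      (Or.inr (by linarith))
  have h1 := (((hpow h'.derivs).sub (hpow h.derivs)).const_mul a).eventually_lt_const
    (u := mu - lam) (by rw [huc, sub_self, mul_zero]; linarith)
  obtain ⟨d, hd, hcd⟩ := (mem_nhdsGT_iff_exists_Ioo_subset' hc.2).1
    (h1.and (Ioo_mem_nhdsGT hc.2))
  rw [mem_Ioi] at hd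
  have hsub : ∀ x ∈ Ioo c d, x ∈ Ioo 0 R := fun x hx =>
    ⟨hc.1.trans_lt hx.1, (hcd hx).2.2⟩
  have hWneg : ∀ x ∈ Ioo c d, v' x * u x - u' x * v x < 0 := by
    intro x hx
    have hanti : StrictAntiOn (fun y => v' y * u y - u' y * v y) (Icc c x) := by
      refine strictAntiOn_of_deriv_neg (convex_Icc c x)
        ((h'.derivs.wronskian_continuousOn h.derivs).mono fun y hy =>
          ⟨hc.1.trans hy.1, hy.2.trans_lt (hsub x hx).2⟩) ?_
      intro y hy
      rw [interior_Icc] at hy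
      have hy' : y ∈ Ioo c d := ⟨hy.1, hy.2.trans hx.2⟩
      rw [(h'.derivs.wronskian h.derivs (hsub y hy')).deriv]
      have h2 : a * (u' y ^ (p - 1) - u y ^ (p - 1)) < mu - lam := (hcd hy').1
      have h3 := mul_pos (h.pos y (hsub y hy')) (h'.pos y (hsub y hy'))
      nlinarith [mul_lt_mul_of_pos_left h2 h3]
    have := hanti (left_mem_Icc.2 hx.1.le) (right_mem_Icc.2 hx.1.le) hx.1
    simpa only [hW] using this
  have hanti : StrictAntiOn (fun y => u' y / u y) (Ioo c d) := by
    refine strictAntiOn_of_deriv_neg (convex_Ioo c d) (fun x hx => ?_) fun x hx => ?_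
    · exact ((h'.derivs.hasDerivAt (hsub x hx)).div (h.derivs.hasDerivAt (hsub x hx))
        (h.pos x (hsub x hx)).ne').continuousAt.continuousWithinAt
    · rw [interior_Ioo] at hx
      have hd := ((h'.derivs.hasDerivAt (hsub x hx)).div (h.derivs.hasDerivAt (hsub x hx))
        (h.pos x (hsub x hx)).ne').deriv
      refine hd.trans_lt ?_
      exact div_neg_of_neg_of_pos (hWneg x hx) (pow_pos (h.pos x (hsub x hx)) 2)
  obtain ⟨x, hx⟩ := exists_between hd
  obtain ⟨y, hy⟩ := exists_between hx.1
  have hy' : y ∈ Ioo c d := ⟨hy.1, hy.2.trans hx.2⟩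
  have h2 : u' x / u x < u' y / u y := hanti hy' hx hy.2
  have h3 : 1 ≤ u' x / u x := (one_le_div (h.pos x (hsub x hx))).2
    (h.le_of_le h' hR ha hp hlt.le x (Ioo_subset_Ico_self (hsub x hx)))
  have h4 : u' y / u y ≤ 1 := by
    refine ge_of_tendsto hlim ?_
    filter_upwards [Ioo_mem_nhdsGT hy.1] with z hz
    exact (hanti ⟨hz.1, hz.2.trans hy'.2⟩ hy' hz.2).le
  linarith

theorem lt_of_lt (h : LargeSolution B R a p lam u v) (h' : LargeSolution B R a p mu u' v')
    (hR : 0 < R) (ha : 0 < a) (hp : 1 < p) (hlt : lam < mu) : ∀ x ∈ Ioo 0 R, u x < u' x := by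
  intro x hx
  have hle := h.le_of_le h' hR ha hp hlt.le
  refine lt_of_le_of_ne (hle x (Ioo_subset_Ico_self hx)) fun heq => ?_
  have hmin : IsLocalMin (fun y => u' y - u y) x := by
    filter_upwards [Ioo_mem_nhds hx.1 hx.2] with y hy
    have := hle y (Ioo_subset_Ico_self hy)
    linarith
  have hd := hmin.hasDerivAt_eq_zero ((h'.derivs.sub h.derivs).hasDerivAt hx)
  refine h.false_of_touch h' hR ha hp hlt (Ioo_subset_Ico_self hx) heq.symm ?_ ?_
  · rw [heq]; linear_combination u' x * hd
  · have : Tendsto (fun y => u' y / u y) (𝓝[>] x) (𝓝 (u' x / u x)) := (((h'.derivs.hasDerivAt hx).div (h.derivs.hasDerivAt hx)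
      (h.pos x hx).ne').continuousAt.tendsto).mono_left (nhdsWithin_le_nhds (s := Ioi x))
    rwa [heq, div_self (h'.pos x hx).ne'] at this

theorem initial_lt_of_lt (h : LargeSolution B R a p lam u v)
    (h' : LargeSolution B R a p mu u' v') (hR : 0 < R) (ha : 0 < a) (hp : 1 < p) (hlt : lam < mu)
    {t s : ℝ} (ht : 0 < t) (hu : u 0 = t * B.dir.1) (hv : v 0 = t * B.dir.2)
    (hu' : u' 0 = s * B.dir.1) (hv' : v' 0 = s * B.dir.2) : t < s := by
  have hlim := h'.tendsto_div_zero h hR ht hu' hv' hu hv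
  have hle : 1 ≤ s / t := by
    refine ge_of_tendsto hlim ?_
    filter_upwards [Ioo_mem_nhdsGT hR] with x hx
    exact (one_le_div (h.pos x hx)).2 (h.le_of_le h' hR ha hp hlt.le x (Ioo_subset_Ico_self hx))
  refine lt_of_le_of_ne ((one_le_div ht).1 hle) fun heq => ?_
  subst heq
  rw [div_self ht.ne'] at hlim
  exact h.false_of_touch h' hR ha hp hlt ⟨le_rfl, hR⟩ (by rw [hu, hu'])
    (h'.wronskian_zero h) hlim

/-! ### Behavior for large parameters of either sign -/

/-- A bounded subsolution lies below the large solution. -/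
theorem sub_le (h : LargeSolution B R a p lam u v) (ha : 0 < a)
    (hp : 1 < p) {φ φ₁ φ₂ : ℝ → ℝ} (hφ : HasDerivs R φ φ₁ φ₂) {M : ℝ}
    (hM : ∀ x ∈ Ioo 0 R, φ x ≤ M) (hR : 0 < R) (h0 : 0 ≤ φ₁ 0 * u 0 - φ 0 * v 0)
    (hsub : ∀ x ∈ Ioo 0 R, φ x * (a * φ x ^ (p - 1) - lam) ≤ φ₂ x) :
    ∀ x ∈ Ioo 0 R, φ x ≤ u x := by
  refine hφ.le_of_sub_super ha hp h.derivs h.pos h0 (lam := lam) (fun x hx _ => hsub x hx)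
    (fun x _ _ => le_rfl) fun ε hε => ?_
  filter_upwards [h.blowup.eventually_ge_atTop M, eventually_mem hR] with x hx hx'
  nlinarith [hM x hx', h.pos x hx']

/-- For the Neumann and Robin operators, `M exp (|β| x)` is a subsolution for large `lam`. -/
theorem exists_forall_le_of_ne_dirichlet (hB : B ≠ .dirichlet) (hR : 0 < R) (ha : 0 < a)
    (hp : 1 < p) {M : ℝ} (hM : 0 < M) : ∃ lam₀, ∀ lam ≥ lam₀, ∀ u v,
    LargeSolution B R a p lam u v → ∀ x ∈ Ico 0 R, M ≤ u x := by
  set k := |B.dir.2| with hk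
  have hk0 : 0 ≤ k := abs_nonneg _
  refine ⟨a * (M * Real.exp (k * R)) ^ (p - 1), fun lam hlam u v h => ?_⟩
  have hexp : ∀ x, HasDerivAt (fun x => Real.exp (k * x)) (k * Real.exp (k * x)) x := fun x => by
    simpa [mul_comm] using ((hasDerivAt_id x).const_mul k).exp
  have hle : ∀ x ∈ Ioo 0 R, Real.exp (k * x) ≤ Real.exp (k * R) := fun x hx =>
    Real.exp_le_exp.2 (mul_le_mul_of_nonneg_left hx.2.le hk0)
  have hIoo : ∀ x ∈ Ioo 0 R, M * Real.exp (k * x) ≤ u x := by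
    refine h.sub_le ha hp (HasDerivs.of_hasDerivAt (fun x _ => (hexp x).const_mul M)
      (fun x _ => ((hexp x).const_mul k).const_mul M)) (M := M * Real.exp (k * R))
      (fun x hx => mul_le_mul_of_nonneg_left (hle x hx) hM.le) hR ?_ ?_
    · obtain ⟨t, ht, hu, hv⟩ := h.exists_initial hR hp
      rw [hu, hv, BoundaryOp.dir_fst_eq_one hB, mul_zero, Real.exp_zero]
      nlinarith [mul_nonneg (mul_pos hM ht).le (sub_nonneg.2 (le_abs_self B.dir.2))]
    · intro x hx
      have hpos : 0 < M * Real.exp (k * x) := mul_pos hM (Real.exp_pos _)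
      have h1 : (M * Real.exp (k * x)) ^ (p - 1) ≤ (M * Real.exp (k * R)) ^ (p - 1) :=
        Real.rpow_le_rpow hpos.le (mul_le_mul_of_nonneg_left (hle x hx) hM.le) (by linarith)
      have h2 : a * (M * Real.exp (k * x)) ^ (p - 1) - lam ≤ 0 := by
        linarith [mul_le_mul_of_nonneg_left h1 ha.le]
      exact (mul_nonpos_of_nonneg_of_nonpos hpos.le h2).trans
        (mul_nonneg hM.le (mul_nonneg hk0 (mul_nonneg hk0 (Real.exp_pos _).le)))
  intro x hx
  refine sub_nonneg.1 (nonneg_of_nonneg_Ioo hR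
    (h.derivs.continuousOn.sub continuousOn_const) (fun y hy => sub_nonneg.2 ?_) x hx)
  refine le_trans ?_ (hIoo y hy)
  exact le_mul_of_one_le_right hM.le (Real.one_le_exp (mul_nonneg hk0 hy.1.le))

/-- For the Dirichlet operator, `M sin (π x / R)` is a subsolution for large `lam`. -/
theorem exists_forall_sin_le (hR : 0 < R) (ha : 0 < a)
    (hp : 1 < p) {M : ℝ} (hM : 0 < M) : ∃ lam₀, ∀ lam ≥ lam₀, ∀ u v,
    LargeSolution .dirichlet R a p lam u v →
      ∀ x ∈ Ioo 0 R, M * Real.sin (Real.pi / R * x) ≤ u x := by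
  set k := Real.pi / R with hk
  have hk0 : 0 < k := div_pos Real.pi_pos hR
  refine ⟨a * M ^ (p - 1) + k ^ 2, fun lam hlam u v h => ?_⟩
  have hsin : ∀ x, HasDerivAt (fun x => Real.sin (k * x)) (k * Real.cos (k * x)) x := fun x => by
    simpa [mul_comm] using ((hasDerivAt_id x).const_mul k).sin
  have hcos : ∀ x, HasDerivAt (fun x => Real.cos (k * x)) (-(k * Real.sin (k * x))) x :=
    fun x => by simpa [mul_comm] using ((hasDerivAt_id x).const_mul k).cos
  have hsin0 : ∀ x ∈ Ioo 0 R, 0 < Real.sin (k * x) := fun x hx => by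
    refine Real.sin_pos_of_pos_of_lt_pi (mul_pos hk0 hx.1) ?_
    calc k * x < k * R := mul_lt_mul_of_pos_left hx.2 hk0
      _ = Real.pi := by rw [hk]; field_simp
  refine h.sub_le ha hp (HasDerivs.of_hasDerivAt (fun x _ => (hsin x).const_mul M)
      (fun x _ => ((hcos x).const_mul k).const_mul M)) (M := M)
      (fun x hx => mul_le_of_le_one_right hM.le (Real.sin_le_one _)) hR ?_ ?_
  · have hb := h.boundary
    simp only [BoundaryOp.dir, mul_zero, mul_one] at hb
    simp [hb]
  · intro x hx
    have hpos : 0 < M * Real.sin (k * x) := mul_pos hM (hsin0 x hx)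
    have h1 : (M * Real.sin (k * x)) ^ (p - 1) ≤ M ^ (p - 1) :=
      Real.rpow_le_rpow hpos.le (mul_le_of_le_one_right hM.le (Real.sin_le_one _)) (by linarith)
    have h2 : a * (M * Real.sin (k * x)) ^ (p - 1) - lam ≤ -k ^ 2 := by
      linarith [mul_le_mul_of_nonneg_left h1 ha.le]
    calc _ ≤ M * Real.sin (k * x) * -k ^ 2 := mul_le_mul_of_nonneg_left h2 hpos.le
      _ = _ := by ring

/-- For `lam → -∞`, a large solution that is bounded by `M` on `[0, c)` is small on `[0, b]`,
`b < c`: the function `M exp (-k (c - x)) + ε exp (-k x)` is a supersolution on `[0, c)`. -/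
theorem exists_forall_le_of_bounded (B : BoundaryOp) (hR : 0 < R) (ha : 0 < a) (hp : 1 < p)
    {M b c ε : ℝ} (hM : 0 < M) (hb : 0 < b) (hbc : b < c) (hcR : c < R) (hε : 0 < ε) :
    ∃ lam₀, ∀ lam ≤ lam₀, ∀ u v, LargeSolution B R a p lam u v →
      (∀ x ∈ Ioo 0 c, u x ≤ M) → ∀ x ∈ Ioc 0 b, u x ≤ 2 * ε := by
  have hlim : ∀ d > 0, ∀ᶠ k in atTop, M * Real.exp (-(k * d)) ≤ ε / 2 := by
    intro d hd
    have h1 : Tendsto (fun k => M * Real.exp (-(k * d))) atTop (𝓝 (M * 0)) :=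
      (Real.tendsto_exp_neg_atTop_nhds_zero.comp (tendsto_id.atTop_mul_const hd)).const_mul M
    rw [mul_zero] at h1
    exact h1.eventually_le_const (half_pos hε)
  obtain ⟨k, hkb, hkc, hkβ, hk0⟩ := ((hlim (c - b) (by linarith)).and ((hlim c (by linarith)).and
    ((eventually_ge_atTop (4 * |B.dir.2|)).and (eventually_gt_atTop 0)))).exists
  refine ⟨-k ^ 2, fun lam hlam u v h hu x hx => ?_⟩
  set e₁ : ℝ → ℝ := fun x => M * Real.exp (-(k * (c - x))) with he₁
  set e₂ : ℝ → ℝ := fun x => ε * Real.exp (-(k * x)) with he₂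
  have hd₁ : ∀ x, HasDerivAt e₁ (k * e₁ x) x := fun x => by
    have := ((((hasDerivAt_id x).const_sub c).const_mul k).neg.exp).const_mul M
    convert! this using 1
    simp only [he₁, id, Pi.neg_apply]; ring
  have hd₂ : ∀ x, HasDerivAt e₂ (-(k * e₂ x)) x := fun x => by
    have := (((hasDerivAt_id x).const_mul k).neg.exp).const_mul ε
    convert! this using 1
    simp only [he₂, id, Pi.neg_apply]; ring
  have h1 : ∀ x, 0 < e₁ x := fun x => mul_pos hM (Real.exp_pos _)
  have h2 : ∀ x, 0 < e₂ x := fun x => mul_pos hε (Real.exp_pos _)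
  have hΨ : HasDerivs c (fun x => e₁ x + e₂ x) (fun x => k * e₁ x + -(k * e₂ x))
      (fun x => k * (k * e₁ x) + -(k * -(k * e₂ x))) :=
    HasDerivs.of_hasDerivAt (fun x _ => (hd₁ x).add (hd₂ x))
      (fun x _ => ((hd₁ x).const_mul k).add ((hd₂ x).const_mul k).neg)
  have hle : ∀ x ∈ Ioo 0 c, u x ≤ e₁ x + e₂ x := by
    refine (h.derivs.mono hcR.le).le_of_sub_super ha hp hΨ (lam := lam)
      (fun x _ => add_pos (h1 x) (h2 x)) ?_ (fun x _ _ => le_rfl) ?_ ?_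
    · obtain ⟨t, ht, hu0, hv0⟩ := h.exists_initial hR hp
      have e10 : e₁ 0 ≤ ε / 2 := by simpa [he₁] using hkc
      have e20 : e₂ 0 = ε := by simp [he₂]
      have h10 := h1 0
      rw [hu0, hv0, e20]
      by_cases hB : B = .dirichlet
      · subst hB
        simp only [BoundaryOp.dir]
        nlinarith [mul_pos ht h10, mul_pos ht hε]
      · rw [BoundaryOp.dir_fst_eq_one hB]
        have h3 : -(|B.dir.2| * (2 * ε)) ≤ B.dir.2 * (e₁ 0 + ε) := by
          have := neg_abs_le B.dir.2
          have := abs_nonneg B.dir.2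
          nlinarith
        have h4 : k * e₁ 0 + -(k * ε) ≤ -(|B.dir.2| * (2 * ε)) := by nlinarith
        nlinarith
    · intro x _ _
      have h3 : 0 ≤ (e₁ x + e₂ x) ^ (p - 1) := Real.rpow_nonneg (add_pos (h1 x) (h2 x)).le _
      have h4 : k ^ 2 ≤ a * (e₁ x + e₂ x) ^ (p - 1) - lam := by
        linarith [mul_nonneg ha.le h3]
      calc _ = (e₁ x + e₂ x) * k ^ 2 := by ring
        _ ≤ _ := mul_le_mul_of_nonneg_left h4 (add_pos (h1 x) (h2 x)).le
    · intro δ hδ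
      have hc0 : 0 < c := by linarith
      have hcont : Tendsto (fun x => e₁ x + e₂ x) (𝓝[<] c) (𝓝 (e₁ c + e₂ c)) :=
        ((hd₁ c).add (hd₂ c)).continuousAt.continuousWithinAt
      have hMc : M < e₁ c + e₂ c := by
        have : e₁ c = M := by simp [he₁]
        linarith [h2 c]
      filter_upwards [hcont.eventually_const_lt hMc, Ioo_mem_nhdsLT hc0] with x hx hx'
      have := hu x hx'
      have := h1 x
      have := h2 x
      nlinarith
  refine (hle x ⟨hx.1, hx.2.trans_lt hbc⟩).trans ?_
  have h3 : e₁ x ≤ ε / 2 := by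
    refine le_trans ?_ hkb
    exact mul_le_mul_of_nonneg_left (Real.exp_le_exp.2 (neg_le_neg
      (mul_le_mul_of_nonneg_left (by linarith [hx.2]) hk0.le))) hM.le
  have h4 : e₂ x ≤ ε := mul_le_of_le_one_right hε.le
    (Real.exp_le_one_iff.2 (neg_nonpos.2 (mul_pos hk0 hx.1).le))
  linarith

end LargeSolution

end LargeSol

namespace LargeSol

/-! ### Differentiability in the parameter -/

theorem le_of_le_Ioo {R : ℝ} (hR : 0 < R) {f g : ℝ → ℝ} (hf : ContinuousOn f (Ico 0 R))
    (hg : ContinuousOn g (Ico 0 R)) (h : ∀ x ∈ Ioo 0 R, f x ≤ g x) : ∀ x ∈ Ico 0 R, f x ≤ g x :=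
  fun x hx => sub_nonneg.1 (nonneg_of_nonneg_Ioo hR (hg.sub hf) (fun y hy => sub_nonneg.2 (h y hy))
    x hx)

theorem BoundaryOp.wronskian_eq_zero {B : BoundaryOp} {y w y' w' : ℝ}
    (h : y * B.dir.2 = w * B.dir.1) (h' : y' * B.dir.2 = w' * B.dir.1) : w * y' - y * w' = 0 := by
  obtain ⟨t, rfl, rfl⟩ := B.exists_eq_mul_dir h
  obtain ⟨s, rfl, rfl⟩ := B.exists_eq_mul_dir h'
  ring

theorem mul_rpow_sub_one {p y : ℝ} (hy : 0 < y) : y * y ^ (p - 1) = y ^ p := by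
  rw [Real.rpow_sub_one hy.ne']; field_simp

/-- First-order expansion of `y ↦ y ^ p`, with an error that is uniform in relative terms. -/
theorem exists_rpow_taylor (p : ℝ) {η : ℝ} (hη : 0 < η) : ∃ δ > 0, ∀ w > 0, ∀ y > 0,
    |y - w| ≤ δ * w → |y * y ^ (p - 1) - w * w ^ (p - 1) - p * w ^ (p - 1) * (y - w)| ≤
      η * (w ^ (p - 1) * |y - w|) := by
  have h1 := (Real.hasDerivAt_rpow_const (x := 1) (p := p) (Or.inl one_ne_zero)).isLittleO.def hη
  obtain ⟨δ, hδ, hball⟩ := Metric.eventually_nhds_iff.1 h1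
  refine ⟨δ / 2, half_pos hδ, fun w hw y hy hyw => ?_⟩
  have ht : dist (y / w) 1 < δ := by
    rw [Real.dist_eq, div_sub_one hw.ne', abs_div, abs_of_pos hw, div_lt_iff₀ hw]
    nlinarith
  have h2 := hball ht
  simp only [Real.one_rpow, mul_one, smul_eq_mul, Real.norm_eq_abs] at h2
  have hwp := Real.rpow_pos_of_pos hw p
  have e1 : y * y ^ (p - 1) - w * w ^ (p - 1) - p * w ^ (p - 1) * (y - w) =
      w ^ p * ((y / w) ^ p - 1 - (y / w - 1) * p) := by
    rw [mul_rpow_sub_one hy, mul_rpow_sub_one hw, Real.div_rpow hy.le hw.le,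
      Real.rpow_sub_one hw.ne']
    field_simp
  have e2 : w ^ (p - 1) * |y - w| = w ^ p * |y / w - 1| := by
    rw [div_sub_one hw.ne', abs_div, abs_of_pos hw, Real.rpow_sub_one hw.ne']
    field_simp
  rw [e1, e2, abs_mul, abs_of_pos hwp]
  nlinarith [mul_le_mul_of_nonneg_left h2 hwp.le]

/-- Secant slopes of `y ↦ y ^ p` with one end at `w` exceed `w ^ (p - 1)` by a fixed factor if the
other end is not too small relative to `w`. -/
theorem exists_rpow_secant {p K : ℝ} (hp : 1 < p) (hK : 1 < K) : ∃ κ > 1, ∀ w > 0, ∀ y > 0,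
    w ≤ K * y → (w ≤ y → κ * w ^ (p - 1) * (y - w) ≤ y * y ^ (p - 1) - w * w ^ (p - 1)) ∧
      (y ≤ w → κ * w ^ (p - 1) * (w - y) ≤ w * w ^ (p - 1) - y * y ^ (p - 1)) := by
  have hK0 : 0 < K := by linarith
  set t := K⁻¹ with ht
  have ht0 : 0 < t := inv_pos.2 hK0
  have ht1 : t < 1 := inv_lt_one_of_one_lt₀ hK
  set κ := (1 - t ^ p) / (1 - t) with hκ
  have hκt : κ * (1 - t) = 1 - t ^ p := div_mul_cancel₀ _ (by linarith)
  have hκ1 : 1 < κ := by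
    rw [hκ, one_lt_div (by linarith)]
    have := Real.rpow_lt_rpow_of_exponent_gt ht0 ht1 hp
    rw [Real.rpow_one] at this
    linarith
  -- `s` is the quotient `y / w`.
  have upper : ∀ s, 1 ≤ s → κ * (s - 1) ≤ s ^ p - 1 := by
    intro s hs
    have b1 := one_add_mul_self_le_rpow_one_add (by linarith : -1 ≤ t - 1) hp.le
    have b2 := one_add_mul_self_le_rpow_one_add (by linarith : -1 ≤ s - 1) hp.le
    rw [add_sub_cancel] at b1 b2
    have hκp : κ ≤ p := by rw [hκ, div_le_iff₀ (by linarith)]; linarith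
    nlinarith
  have lower : ∀ s, t ≤ s → s ≤ 1 → κ * (1 - s) ≤ 1 - s ^ p := by
    intro s hs hs1
    have hconv := (convexOn_rpow hp.le).2 (mem_Ici.2 ht0.le) (mem_Ici.2 zero_le_one)
      (div_nonneg (by linarith) (by linarith) : 0 ≤ (1 - s) / (1 - t))
      (div_nonneg (by linarith) (by linarith) : 0 ≤ (s - t) / (1 - t))
      (by rw [← add_div]; rw [div_eq_one_iff_eq (by linarith)]; ring)
    have hne : 1 - t ≠ 0 := by linarith
    have e : (1 - s) / (1 - t) * t + (s - t) / (1 - t) * 1 = s := by field_simp; ring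
    simp only [smul_eq_mul, Real.one_rpow] at hconv
    rw [e] at hconv
    have e2 : (1 - s) / (1 - t) * t ^ p + (s - t) / (1 - t) * 1 = 1 - κ * (1 - s) := by
      rw [hκ]; field_simp; ring
    linarith
  refine ⟨κ, hκ1, fun w hw y hy hwy => ?_⟩
  have hwp := Real.rpow_pos_of_pos hw p
  have e1 : y * y ^ (p - 1) = w ^ p * (y / w) ^ p := by
    rw [mul_rpow_sub_one hy, Real.div_rpow hy.le hw.le]; field_simp
  have e2 : w ^ (p - 1) = w ^ p / w := Real.rpow_sub_one hw.ne' p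
  rw [mul_rpow_sub_one hw, e1, e2]
  refine ⟨fun h => ?_, fun h => ?_⟩
  · have := mul_le_mul_of_nonneg_left (upper (y / w) ((one_le_div hw).2 h)) hwp.le
    calc _ = w ^ p * (κ * (y / w - 1)) := by field_simp
      _ ≤ _ := this
      _ = _ := by ring
  · have := mul_le_mul_of_nonneg_left (lower (y / w)
      (by rw [ht, le_div_iff₀ hw, inv_mul_le_iff₀ hK0]; exact hwy) ((div_le_one hw).2 h)) hwp.le
    calc _ = w ^ p * (κ * (1 - y / w)) := by field_simp
      _ ≤ _ := this
      _ = _ := by ring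

/-- `Φ` is comparable to `w` and is a strict supersolution, with the boundary operator `B`, of the
linear operator `-d²/dx² + κ a w ^ (p - 1) - lam`. -/
structure IsBarrier (B : BoundaryOp) (R a p lam κ C : ℝ) (w Φ Φ₁ Φ₂ : ℝ → ℝ) : Prop where
  derivs : HasDerivs R Φ Φ₁ Φ₂
  boundary : Φ 0 * B.dir.2 = Φ₁ 0 * B.dir.1
  le : ∀ x ∈ Ioo 0 R, w x ≤ Φ x
  le_mul : ∀ x ∈ Ioo 0 R, Φ x ≤ C * w x
  super : ∀ x ∈ Ioo 0 R,
    Φ₂ x ≤ (κ * a * w x ^ (p - 1) - lam) * Φ x - (w x + w x * w x ^ (p - 1))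

namespace LargeSolution

variable {B : BoundaryOp} {R a p lam mu : ℝ} {u v u' v' w w₁ : ℝ → ℝ}

theorem exists_lower_bound (h : LargeSolution B R a p lam u v) (hR : 0 < R)
    {c : ℝ} (hc : 0 ≤ c) (hpos : ∀ x ∈ Ico c R, 0 < u x) :
    ∃ m > 0, ∀ x ∈ Ico c R, m ≤ u x := by
  obtain ⟨d, hdR, hd⟩ := (mem_nhdsLT_iff_exists_Ioo_subset' hR).1 (h.blowup.eventually_ge_atTop 1)
  rw [mem_Iio] at hdR
  rcases le_or_gt c d with hcd | hcd
  · obtain ⟨y, hy, hmin⟩ := isCompact_Icc.exists_isMinOn (nonempty_Icc.2 hcd)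
      (h.derivs.continuousOn.mono fun x hx => ⟨hc.trans hx.1, hx.2.trans_lt hdR⟩)
    refine ⟨min (u y) 1, lt_min (hpos y ⟨hy.1, hy.2.trans_lt hdR⟩) one_pos, fun x hx => ?_⟩
    rcases le_or_gt x d with hxd | hxd
    · exact (min_le_left _ _).trans (hmin ⟨hx.1, hxd⟩)
    · exact (min_le_right _ _).trans (hd ⟨hxd, hx.2⟩)
  · exact ⟨1, one_pos, fun x hx => hd ⟨hcd.trans_le hx.1, hx.2⟩⟩

theorem exists_deriv_lower_bound (h : LargeSolution B R a p lam u v) (hR : 0 < R) (ha : 0 < a)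
    (hp : 1 < p) : ∃ N, 0 ≤ N ∧ ∀ x ∈ Ico 0 R, -N ≤ v x := by
  obtain ⟨d, hdR, hd⟩ := (mem_nhdsLT_iff_exists_Ioo_subset' hR).1
    (h.eventually_deriv_pos hR ha hp)
  rw [mem_Iio] at hdR
  obtain ⟨N, hN⟩ := isCompact_Icc.exists_bound_of_continuousOn (s := Icc 0 d)
    (h.derivs.continuousOn_fst.mono fun x hx => ⟨hx.1, hx.2.trans_lt hdR⟩)
  refine ⟨max N 0, le_max_right _ _, fun x hx => ?_⟩
  rcases le_or_gt x d with hxd | hxd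
  · have := neg_le_of_abs_le (hN x ⟨hx.1, hxd⟩)
    exact (neg_le_neg (le_max_left _ _)).trans this
  · exact (neg_nonpos.2 (le_max_right _ _)).trans (hd ⟨hxd, hx.2⟩ : 0 < v x).le

/-- The weight `ψ = C - A x²` used for the barrier `w ψ`: a quadratic correction is needed for the
Dirichlet operator, for which `w ^ (p - 1)` degenerates at `0`. -/
theorem exists_weight (h : LargeSolution B R a p lam w w₁) (hR : 0 < R) (ha : 0 < a)
    (hp : 1 < p) : ∃ A D, 0 ≤ A ∧ ∀ x ∈ Ioo 0 R, w x + w x * w x ^ (p - 1) ≤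
      D * (w x * w x ^ (p - 1)) + 4 * A * x * w₁ x + 2 * A * w x := by
  have hp1 : 0 < p - 1 := by linarith
  by_cases hB : B = .dirichlet
  · obtain ⟨t, ht, -, hv0⟩ := h.exists_initial hR hp
    have hv : 0 < w₁ 0 := by rw [hv0, hB]; simpa [BoundaryOp.dir] using ht
    have h0 : ∀ᶠ x in 𝓝[>] 0, 0 < w₁ x :=
      ((h.derivs.snd 0 ⟨le_rfl, hR⟩).continuousWithinAt.mono_of_mem_nhdsWithin
        (Ico_mem_nhdsGT hR)).tendsto.eventually_const_lt hv
    obtain ⟨c, hc0, hc⟩ := (mem_nhdsGT_iff_exists_Ioo_subset' hR).1 h0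
    rw [mem_Ioi] at hc0
    obtain ⟨m, hm, hmw⟩ := h.exists_lower_bound hR hc0.le
      (fun x hx => h.pos x ⟨hc0.trans_le hx.1, hx.2⟩)
    obtain ⟨N, hN, hNw⟩ := h.exists_deriv_lower_bound hR ha hp
    have hmp := Real.rpow_pos_of_pos hm (p - 1)
    refine ⟨1, 1 + 4 * R * N / (m * m ^ (p - 1)), zero_le_one, fun x hx => ?_⟩
    have hwx := h.pos x hx
    have hq := Real.rpow_pos_of_pos hwx (p - 1)
    have hprod := mul_pos hwx hq
    rcases lt_or_ge x c with hxc | hxc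
    · have h1 : 0 < w₁ x := hc ⟨hx.1, hxc⟩
      have h2 : 0 ≤ 4 * R * N / (m * m ^ (p - 1)) * (w x * w x ^ (p - 1)) := by positivity
      have h3 := mul_pos hx.1 h1
      linarith
    · have h1 := hmw x ⟨hxc, hx.2⟩
      have h2 : m * m ^ (p - 1) ≤ w x * w x ^ (p - 1) :=
        mul_le_mul h1 (Real.rpow_le_rpow hm.le h1 hp1.le) hmp.le hwx.le
      have h3 : 4 * R * N ≤ 4 * R * N / (m * m ^ (p - 1)) * (w x * w x ^ (p - 1)) := by
        rw [div_mul_eq_mul_div, le_div_iff₀ (mul_pos hm hmp)]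
        exact mul_le_mul_of_nonneg_left h2 (by positivity)
      have h4 := hNw x (Ioo_subset_Ico_self hx)
      have h5 : -(R * N) ≤ x * w₁ x := by nlinarith [hx.1, hx.2]
      linarith
  · obtain ⟨t, ht, hu0, -⟩ := h.exists_initial hR hp
    rw [BoundaryOp.dir_fst_eq_one hB, mul_one] at hu0
    obtain ⟨m, hm, hmw⟩ := h.exists_lower_bound hR le_rfl (fun x hx => by
      rcases hx.1.eq_or_lt with h' | h'
      · rw [← h', hu0]; exact ht
      · exact h.pos x ⟨h', hx.2⟩)
    have hmp := Real.rpow_pos_of_pos hm (p - 1)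
    refine ⟨0, 1 + 1 / m ^ (p - 1), le_rfl, fun x hx => ?_⟩
    have h1 : m ^ (p - 1) ≤ w x ^ (p - 1) :=
      Real.rpow_le_rpow hm.le (hmw x (Ioo_subset_Ico_self hx)) hp1.le
    have h2 : 1 ≤ 1 / m ^ (p - 1) * w x ^ (p - 1) := by
      rw [div_mul_eq_mul_div, one_mul]; exact (one_le_div hmp).2 h1
    nlinarith [mul_le_mul_of_nonneg_left h2 (h.pos x hx).le]

theorem exists_isBarrier (h : LargeSolution B R a p lam w w₁) (hR : 0 < R) (ha : 0 < a)
    (hp : 1 < p) {κ : ℝ} (hκ : 1 < κ) :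
    ∃ C > 0, ∃ Φ Φ₁ Φ₂, IsBarrier B R a p lam κ C w Φ Φ₁ Φ₂ := by
  obtain ⟨A, D, hA, hAD⟩ := h.exists_weight hR ha hp
  have hκa : 0 < (κ - 1) * a := mul_pos (by linarith) ha
  set C := A * R ^ 2 + max 1 (D / ((κ - 1) * a)) with hC
  have hC0 : 0 < C := by positivity
  have hψ : ∀ x ∈ Ioo 0 R, max 1 (D / ((κ - 1) * a)) ≤ C - A * x ^ 2 ∧ C - A * x ^ 2 ≤ C := by
    intro x hx
    have h1 : x ^ 2 ≤ R ^ 2 := pow_le_pow_left₀ hx.1.le hx.2.le 2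
    exact ⟨by linarith [mul_le_mul_of_nonneg_left h1 hA],
      by linarith [mul_nonneg hA (sq_nonneg x)]⟩
  have hd : ∀ x, HasDerivAt (fun x => C - A * x ^ 2) (-(2 * A * x)) x := fun x => by
    have := ((hasDerivAt_pow 2 x).const_mul A).const_sub C
    convert! this using 1
    push_cast; ring
  have hd2 : ∀ x, HasDerivAt (fun x => -(2 * A * x)) (-(2 * A)) x := fun x => by
    have := ((hasDerivAt_id x).const_mul (2 * A)).neg
    convert! this using 1
    ring
  refine ⟨C, hC0, fun x => w x * (C - A * x ^ 2),
    fun x => w₁ x * (C - A * x ^ 2) + w x * -(2 * A * x),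
    fun x => w x * (a * w x ^ (p - 1) - lam) * (C - A * x ^ 2) + w₁ x * -(2 * A * x) +
      (w₁ x * -(2 * A * x) + w x * -(2 * A)), ⟨fun x hx => ?_, fun x hx => ?_⟩, ?_, ?_, ?_, ?_⟩
  · exact (h.derivs.fst x hx).mul (hd x).hasDerivWithinAt
  · exact ((h.derivs.snd x hx).mul (hd x).hasDerivWithinAt).add
      ((h.derivs.fst x hx).mul (hd2 x).hasDerivWithinAt)
  · simp only [mul_zero, neg_zero, add_zero]
    linear_combination (C - A * 0 ^ 2) * h.boundary
  · intro x hx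
    exact le_mul_of_one_le_right (h.pos x hx).le ((le_max_left _ _).trans (hψ x hx).1)
  · intro x hx
    rw [mul_comm C]
    exact mul_le_mul_of_nonneg_left (hψ x hx).2 (h.pos x hx).le
  · intro x hx
    have h1 : D ≤ (κ - 1) * a * (C - A * x ^ 2) := by
      rw [mul_comm, ← div_le_iff₀ hκa]
      exact (le_max_right _ _).trans (hψ x hx).1
    have h2 := mul_le_mul_of_nonneg_right h1
      (mul_pos (h.pos x hx) (Real.rpow_pos_of_pos (h.pos x hx) (p - 1))).le
    have h3 := hAD x hx
    linarith

/-- Comparison with a multiple of a barrier. -/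
theorem le_barrier (h : LargeSolution B R a p lam w w₁) {κ C M : ℝ} {Φ Φ₁ Φ₂ r r₁ r₂ : ℝ → ℝ}
    (hΦ : IsBarrier B R a p lam κ C w Φ Φ₁ Φ₂) (hR : 0 < R) (hM : 0 ≤ M)
    (hr : HasDerivs R r r₁ r₂) (hr0 : r 0 * B.dir.2 = r₁ 0 * B.dir.1)
    (hr2 : ∀ x ∈ Ioo 0 R, M * Φ x < r x → (κ * a * w x ^ (p - 1) - lam) * r x -
      M * (w x + w x * w x ^ (p - 1)) ≤ r₂ x)
    (hlim : ∀ ε > 0, ∀ᶠ x in 𝓝[<] R, r x ≤ ε * w x) : ∀ x ∈ Ioo 0 R, r x ≤ M * C * w x := by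
  intro x hx
  have hΦpos : ∀ x ∈ Ioo 0 R, 0 < Φ x := fun x hx => (h.pos x hx).trans_le (hΦ.le x hx)
  have key := (hr.sub (hΦ.derivs.const_mul M)).nonpos_of_wronskian hΦ.derivs hΦpos ?_ ?_ ?_ x hx
  · have := mul_le_mul_of_nonneg_left (hΦ.le_mul x hx) hM
    linarith
  · have h1 := BoundaryOp.wronskian_eq_zero hr0 hΦ.boundary
    linarith
  · intro y hy hlt
    have h1 := hr2 y hy (sub_pos.1 hlt)
    have h2 := hΦ.super y hy
    have h3 := mul_pos (h.pos y hy) (Real.rpow_pos_of_pos (h.pos y hy) (p - 1))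
    have h4 := h.pos y hy
    have h5 : Φ₂ y ≤ (κ * a * w y ^ (p - 1) - lam) * Φ y := by linarith
    have h6 : (κ * a * w y ^ (p - 1) - lam) * (r y - M * Φ y) ≤ r₂ y - M * Φ₂ y := by
      linarith [mul_le_mul_of_nonneg_left h2 hM]
    calc _ ≤ (r y - M * Φ y) * ((κ * a * w y ^ (p - 1) - lam) * Φ y) :=
          mul_le_mul_of_nonneg_left h5 hlt.le
      _ = (κ * a * w y ^ (p - 1) - lam) * (r y - M * Φ y) * Φ y := by ring
      _ ≤ _ := mul_le_mul_of_nonneg_right h6 (hΦpos y hy).le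
  · intro ε hε
    filter_upwards [hlim ε hε, eventually_mem hR] with y hy hy'
    have h1 := mul_le_mul_of_nonneg_left (hΦ.le y hy') hε.le
    have h2 := mul_nonneg hM (hΦpos y hy').le
    linarith

theorem eventually_abs_sub_le (h : LargeSolution B R a p lam u v)
    (h' : LargeSolution B R a p mu u' v') (hR : 0 < R) (ha : 0 < a) (hp : 1 < p) {ε : ℝ}
    (hε : 0 < ε) : ∀ᶠ x in 𝓝[<] R, |u x - u' x| ≤ ε * u' x := by
  have h1 := (h.tendsto_div h' hR ha hp).eventually (Metric.closedBall_mem_nhds 1 hε)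
  filter_upwards [h1, eventually_mem hR] with x hx hx'
  have hpos := h'.pos x hx'
  rwa [Real.dist_eq, div_sub_one hpos.ne', abs_div, abs_of_pos hpos,
    div_le_iff₀ hpos] at hx

/-- Large solutions depend on the parameter in a Lipschitz way, relative to their size. -/
theorem exists_lipschitz {L V : ℝ → ℝ → ℝ} (hL : ∀ mu, LargeSolution B R a p mu (L mu) (V mu))
    (hR : 0 < R) (ha : 0 < a) (hp : 1 < p) (lam : ℝ) : ∃ K, 0 ≤ K ∧ ∀ mu, |mu - lam| ≤ 1 →
      ∀ x ∈ Ioo 0 R, |L mu x - L lam x| ≤ K * |mu - lam| * L lam x := by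
  obtain ⟨K₁, hK₁, h₁⟩ := (hL (lam + 1)).exists_le_mul (hL lam) hR ha hp
  obtain ⟨K₂, hK₂, h₂⟩ := (hL lam).exists_le_mul (hL (lam - 1)) hR ha hp
  obtain ⟨κ, hκ, hsec⟩ := exists_rpow_secant hp hK₂
  obtain ⟨C, hC, Φ, Φ₁, Φ₂, hΦ⟩ := (hL lam).exists_isBarrier hR ha hp hκ
  refine ⟨K₁ * C, by positivity, fun mu hmu x hx => ?_⟩
  have hmu' := abs_le.1 hmu
  set δ := |mu - lam| with hδ
  have hδ0 : 0 ≤ δ := abs_nonneg _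
  have hupper : ∀ y ∈ Ioo 0 R, L mu y ≤ K₁ * L lam y := fun y hy =>
    ((hL mu).le_of_le (hL (lam + 1)) hR ha hp (by linarith) y (Ioo_subset_Ico_self hy)).trans
      (h₁ y hy)
  have hlower : ∀ y ∈ Ioo 0 R, L lam y ≤ K₂ * L mu y := fun y hy =>
    (h₂ y hy).trans (mul_le_mul_of_nonneg_left
      ((hL (lam - 1)).le_of_le (hL mu) hR ha hp (by linarith) y (Ioo_subset_Ico_self hy))
      (by linarith))
  have herr : ∀ y ∈ Ioo 0 R, |(mu - lam) * L mu y| ≤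
      K₁ * δ * (L lam y + L lam y * L lam y ^ (p - 1)) := by
    intro y hy
    have h3 := (hL lam).pos y hy
    have h4 := Real.rpow_pos_of_pos h3 (p - 1)
    rw [abs_mul, abs_of_pos ((hL mu).pos y hy), ← hδ]
    have h5 := mul_le_mul_of_nonneg_left (hupper y hy) hδ0
    have h6 : 0 ≤ K₁ * δ * (L lam y * L lam y ^ (p - 1)) := by positivity
    linarith
  have hup := (hL lam).le_barrier hΦ hR (M := K₁ * δ) (by positivity)
    ((hL mu).derivs.sub (hL lam).derivs)
    (by linear_combination (hL mu).boundary - (hL lam).boundary)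
    (fun y hy hlt => by
      have h3 := (hL lam).pos y hy
      have h4 : 0 < K₁ * δ * Φ y ∨ 0 = K₁ * δ * Φ y := by
        have : 0 ≤ K₁ * δ * Φ y := mul_nonneg (by positivity) (h3.trans_le (hΦ.le y hy)).le
        exact this.lt_or_eq
      have h5 : L lam y ≤ L mu y := by rcases h4 with h4 | h4 <;> linarith
      have h6 := mul_le_mul_of_nonneg_left
        ((hsec _ h3 _ ((hL mu).pos y hy) (hlower y hy)).1 h5) ha.le
      have h7 := (abs_le.1 (herr y hy)).2
      linarith)
    (fun ε hε => ((hL mu).eventually_abs_sub_le (hL lam) hR ha hp hε).mono fun y hy =>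
      (le_abs_self _).trans hy) x hx
  have hlo := (hL lam).le_barrier hΦ hR (M := K₁ * δ) (by positivity)
    ((hL lam).derivs.sub (hL mu).derivs)
    (by linear_combination (hL lam).boundary - (hL mu).boundary)
    (fun y hy hlt => by
      have h3 := (hL lam).pos y hy
      have h4 : 0 ≤ K₁ * δ * Φ y := mul_nonneg (by positivity) (h3.trans_le (hΦ.le y hy)).le
      have h5 : L mu y ≤ L lam y := by linarith
      have h6 := mul_le_mul_of_nonneg_left
        ((hsec _ h3 _ ((hL mu).pos y hy) (hlower y hy)).2 h5) ha.le
      have h7 := (abs_le.1 (herr y hy)).1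
      linarith)
    (fun ε hε => ((hL mu).eventually_abs_sub_le (hL lam) hR ha hp hε).mono fun y hy =>
      (neg_le_abs _).trans' (neg_sub _ _).ge |>.trans hy) x hx
  rw [abs_le]
  constructor <;> linarith

/-- The difference quotients satisfy the linearized equation up to a small error, so they form a
Cauchy family relative to the size of the solution. -/
theorem exists_quotient_cauchy {L V : ℝ → ℝ → ℝ}
    (hL : ∀ mu, LargeSolution B R a p mu (L mu) (V mu))
    (hR : 0 < R) (ha : 0 < a) (hp : 1 < p) (lam : ℝ) {ε : ℝ} (hε : 0 < ε) : ∃ δ > 0,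
      ∀ mu nu, mu ≠ lam → |mu - lam| < δ → nu ≠ lam → |nu - lam| < δ → ∀ x ∈ Ico 0 R,
        |(L mu x - L lam x) / (mu - lam) - (L nu x - L lam x) / (nu - lam)| ≤ ε * L lam x := by
  obtain ⟨K, hK, hlip⟩ := exists_lipschitz hL hR ha hp lam
  obtain ⟨C, hC, Φ, Φ₁, Φ₂, hΦ⟩ := (hL lam).exists_isBarrier hR ha hp hp
  set η := ε / (2 * C) with hη
  have hη0 : 0 < η := by positivity
  set η' := η / (a * (K + 1)) with hη'
  have hη'0 : 0 < η' := by positivity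
  obtain ⟨τ, hτ, htaylor⟩ := exists_rpow_taylor p hη'0
  set δ := min 1 (min (τ / (K + 1)) (η / (K + 1))) with hδ
  have hδ0 : 0 < δ := by positivity
  set q : ℝ → ℝ → ℝ := fun mu x => (mu - lam)⁻¹ * (L mu x - L lam x) with hq
  set q₁ : ℝ → ℝ → ℝ := fun mu x => (mu - lam)⁻¹ * (V mu x - V lam x) with hq₁
  set q₂ : ℝ → ℝ → ℝ := fun mu x => (mu - lam)⁻¹ * (L mu x * (a * L mu x ^ (p - 1) - mu) -
    L lam x * (a * L lam x ^ (p - 1) - lam)) with hq₂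
  have hqd : ∀ mu, HasDerivs R (q mu) (q₁ mu) (q₂ mu) := fun mu =>
    ((hL mu).derivs.sub (hL lam).derivs).const_mul _
  have hqb : ∀ mu, q mu 0 * B.dir.2 = q₁ mu 0 * B.dir.1 := fun mu => by
    simp only [hq, hq₁]
    linear_combination (mu - lam)⁻¹ * ((hL mu).boundary - (hL lam).boundary)
  have hqlim : ∀ mu, ∀ ε > 0, ∀ᶠ x in 𝓝[<] R, |q mu x| ≤ ε * L lam x := by
    intro mu ε hε
    have hpos : 0 < |(mu - lam)⁻¹| + 1 := by positivity
    filter_upwards [(hL mu).eventually_abs_sub_le (hL lam) hR ha hp (div_pos hε hpos),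
      eventually_mem hR] with x hx hx'
    simp only [hq, abs_mul]
    have h1 := (hL lam).pos x hx'
    have h2 : ε / (|(mu - lam)⁻¹| + 1) * L lam x * (|(mu - lam)⁻¹| + 1) = ε * L lam x := by
      field_simp
    nlinarith [abs_nonneg (mu - lam)⁻¹, abs_nonneg (L mu x - L lam x),
      mul_le_mul_of_nonneg_right hx hpos.le]
  -- The linearized equation is `q'' = (p a w ^ (p - 1) - lam) q - w` with `w = L lam`.
  have hlin : ∀ mu, mu ≠ lam → |mu - lam| < δ → ∀ x ∈ Ioo 0 R,
      |q₂ mu x - (p * a * L lam x ^ (p - 1) - lam) * q mu x + L lam x| ≤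
        η * (L lam x + L lam x * L lam x ^ (p - 1)) := by
    intro mu hmu hmuδ x hx
    have hw := (hL lam).pos x hx
    have hwp := Real.rpow_pos_of_pos hw (p - 1)
    have hne : mu - lam ≠ 0 := sub_ne_zero.2 hmu
    have hd0 : 0 < |mu - lam| := abs_pos.2 hne
    have h1 := hlip mu (hmuδ.le.trans (min_le_left _ _)) x hx
    have hτ' : |mu - lam| * (K + 1) ≤ τ := by
      rw [← le_div_iff₀ (by positivity)]
      exact hmuδ.le.trans ((min_le_right _ _).trans (min_le_left _ _))
    have hη'' : |mu - lam| * (K + 1) ≤ η := by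
      rw [← le_div_iff₀ (by positivity)]
      exact hmuδ.le.trans ((min_le_right _ _).trans (min_le_right _ _))
    have h2 : |L mu x - L lam x| ≤ |mu - lam| * (K + 1) * L lam x := by nlinarith
    have h3 := htaylor _ hw _ ((hL mu).pos x hx) (h2.trans (mul_le_mul_of_nonneg_right hτ' hw.le))
    have e : q₂ mu x - (p * a * L lam x ^ (p - 1) - lam) * q mu x + L lam x =
        a * (mu - lam)⁻¹ * (L mu x * L mu x ^ (p - 1) - L lam x * L lam x ^ (p - 1) -
          p * L lam x ^ (p - 1) * (L mu x - L lam x)) - (L mu x - L lam x) := by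
      simp only [hq₂, hq]
      field_simp
      ring
    rw [e]
    refine (abs_sub _ _).trans ?_
    have h4 : |a * (mu - lam)⁻¹ * (L mu x * L mu x ^ (p - 1) - L lam x * L lam x ^ (p - 1) -
          p * L lam x ^ (p - 1) * (L mu x - L lam x))| ≤ η * (L lam x * L lam x ^ (p - 1)) := by
      rw [abs_mul, abs_mul, abs_of_pos ha, abs_inv]
      calc _ ≤ a * |mu - lam|⁻¹ * (η' * (L lam x ^ (p - 1) *
            (|mu - lam| * (K + 1) * L lam x))) := by
              refine mul_le_mul_of_nonneg_left (h3.trans ?_) (by positivity)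
              exact mul_le_mul_of_nonneg_left (mul_le_mul_of_nonneg_left h2 hwp.le) hη'0.le
        _ = _ := by rw [hη']; field_simp
    have h5 := h2.trans (mul_le_mul_of_nonneg_right hη'' hw.le)
    linarith
  refine ⟨δ, hδ0, fun mu nu hmu hmuδ hnu hnuδ => ?_⟩
  have key : ∀ mu nu, mu ≠ lam → |mu - lam| < δ → nu ≠ lam → |nu - lam| < δ → ∀ x ∈ Ioo 0 R,
      q mu x - q nu x ≤ 2 * η * C * L lam x := by
    intro mu nu hmu hmuδ hnu hnuδ
    refine (hL lam).le_barrier hΦ hR (by positivity) ((hqd mu).sub (hqd nu)) ?_ ?_ ?_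
    · linear_combination hqb mu - hqb nu
    · intro x hx _
      have h1 := (abs_le.1 (hlin mu hmu hmuδ x hx)).1
      have h2 := (abs_le.1 (hlin nu hnu hnuδ x hx)).2
      linarith
    · intro ε hε
      filter_upwards [hqlim mu (ε / 2) (half_pos hε), hqlim nu (ε / 2) (half_pos hε)] with x h1 h2
      linarith [(abs_le.1 h1).2, (abs_le.1 h2).1]
  have hηC : 2 * η * C = ε := by rw [hη]; field_simp
  rw [hηC] at key
  have hIoo : ∀ x ∈ Ioo 0 R, |q mu x - q nu x| ≤ ε * L lam x := fun x hx => abs_le.2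
    ⟨by linarith [key nu mu hnu hnuδ hmu hmuδ x hx], key mu nu hmu hmuδ hnu hnuδ x hx⟩
  have hIco := le_of_le_Ioo hR ((hqd mu).continuousOn.sub (hqd nu).continuousOn).abs
    (continuousOn_const.mul (hL lam).derivs.continuousOn) hIoo
  intro x hx
  rw [div_eq_inv_mul, div_eq_inv_mul]
  exact hIco x hx

theorem differentiableIntoC {L V : ℝ → ℝ → ℝ}
    (hL : ∀ mu, LargeSolution B R a p mu (L mu) (V mu))
    (hR : 0 < R) (ha : 0 < a) (hp : 1 < p) : DifferentiableIntoC R L := by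
  intro lam
  set q : ℝ → ℝ → ℝ := fun mu x => (L mu x - L lam x) / (mu - lam) with hq
  have hcauchy : ∀ ε > 0, ∃ S ∈ 𝓝[≠] lam, ∀ mu ∈ S, ∀ nu ∈ S, ∀ x ∈ Ico 0 R,
      |q mu x - q nu x| ≤ ε * L lam x := by
    intro ε hε
    obtain ⟨δ, hδ, h⟩ := exists_quotient_cauchy hL hR ha hp lam hε
    refine ⟨{mu | mu ≠ lam ∧ |mu - lam| < δ}, ?_, fun mu hmu nu hnu =>
      h mu nu hmu.1 hmu.2 hnu.1 hnu.2⟩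
    filter_upwards [self_mem_nhdsWithin, nhdsWithin_le_nhds (Metric.ball_mem_nhds lam hδ)]
      with mu h1 h2 using ⟨h1, h2⟩
  have hex : ∀ x ∈ Ico 0 R, ∃ y, Tendsto (fun mu => q mu x) (𝓝[≠] lam) (𝓝 y) := by
    intro x hx
    refine cauchy_map_iff_exists_tendsto.1 (Metric.cauchy_iff.2 ⟨inferInstance, fun ε hε => ?_⟩)
    have hnn := (hL lam).nonneg hR x hx
    obtain ⟨S, hS, h⟩ := hcauchy (ε / (L lam x + 1)) (by positivity)
    refine ⟨_, image_mem_map hS, ?_⟩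
    rintro _ ⟨mu, hmu, rfl⟩ _ ⟨nu, hnu, rfl⟩
    rw [Real.dist_eq]
    refine (h mu hmu nu hnu x hx).trans_lt ?_
    rw [div_mul_eq_mul_div, div_lt_iff₀ (by positivity)]
    nlinarith
  choose! D hD using hex
  have hunif : ∀ ε > 0, ∀ᶠ mu in 𝓝[≠] lam, ∀ x ∈ Ico 0 R, |D x - q mu x| ≤ ε * L lam x := by
    intro ε hε
    obtain ⟨S, hS, h⟩ := hcauchy ε hε
    filter_upwards [hS] with mu hmu x hx
    refine le_of_tendsto (((hD x hx).sub_const (q mu x)).abs) ?_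
    filter_upwards [hS] with nu hnu using h nu hnu mu hmu x hx
  have hK : ∀ K : Set ℝ, IsCompact K → K ⊆ Ico 0 R → TendstoUniformlyOn q D (𝓝[≠] lam) K := by
    intro K hK hKR
    obtain ⟨M, hM⟩ := hK.exists_bound_of_continuousOn ((hL lam).derivs.continuousOn.mono hKR)
    rw [Metric.tendstoUniformlyOn_iff]
    intro ε hε
    filter_upwards [hunif (ε / (|M| + 1)) (by positivity)] with mu hmu x hx
    rw [Real.dist_eq]
    refine (hmu x (hKR hx)).trans_lt ?_
    have h1 : L lam x ≤ |M| := (le_abs_self _).trans ((hM x hx).trans (le_abs_self _))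
    rw [div_mul_eq_mul_div, div_lt_iff₀ (by positivity)]
    nlinarith
  refine ⟨D, fun x hx => ?_, hK⟩
  obtain ⟨c, hxc, hcR⟩ := exists_between hx.2
  have hsub : Icc 0 c ⊆ Ico 0 R := fun y hy => ⟨hy.1, hy.2.trans_lt hcR⟩
  have hcont : ContinuousOn D (Icc 0 c) := by
    refine (hK _ isCompact_Icc hsub).continuousOn (Frequently.of_forall fun mu => ?_)
    exact (((hL mu).derivs.continuousOn.sub (hL lam).derivs.continuousOn).div_const _).mono hsub
  refine (hcont x ⟨hx.1, hxc.le⟩).mono_of_mem_nhdsWithin ?_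
  rw [mem_nhdsWithin]
  exact ⟨Iio c, isOpen_Iio, hxc, fun y hy => ⟨hy.2.1, hy.1.le⟩⟩

end LargeSolution

end LargeSol

namespace LargeSol

/-! ### Initial value problems for `u'' = g(u)` -/

/-- `u` solves `u'' = g(u)` on `[c, b]`, with one-sided derivatives at the ends, and `v = u'`. -/
def IsTrajOn (g : ℝ → ℝ) (c b : ℝ) (u v : ℝ → ℝ) : Prop :=
  ∀ x ∈ Icc c b, HasDerivWithinAt u (v x) (Icc c b) x ∧ HasDerivWithinAt v (g (u x)) (Icc c b) x

namespace IsTrajOn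

variable {g g' : ℝ → ℝ} {c b : ℝ} {u v u' v' : ℝ → ℝ}

theorem continuousOn (h : IsTrajOn g c b u v) : ContinuousOn u (Icc c b) :=
  fun x hx => (h x hx).1.continuousWithinAt

theorem continuousOn_snd (h : IsTrajOn g c b u v) : ContinuousOn v (Icc c b) :=
  fun x hx => (h x hx).2.continuousWithinAt

theorem mono (h : IsTrajOn g c b u v) {c' b' : ℝ} (hc : c ≤ c') (hb : b' ≤ b) :
    IsTrajOn g c' b' u v := fun x hx =>
  have hx' : x ∈ Icc c b := ⟨hc.trans hx.1, hx.2.trans hb⟩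
  ⟨(h x hx').1.mono (Icc_subset_Icc hc hb), (h x hx').2.mono (Icc_subset_Icc hc hb)⟩

theorem congr_field (h : IsTrajOn g c b u v) (hg : ∀ x ∈ Icc c b, g (u x) = g' (u x)) :
    IsTrajOn g' c b u v := fun x hx => ⟨(h x hx).1, hg x hx ▸ (h x hx).2⟩

theorem hasDerivs (h : IsTrajOn g 0 b u v) : HasDerivs b u v (fun x => g (u x)) :=
  ⟨fun x hx => (h x (Ico_subset_Icc_self hx)).1.mono Ico_subset_Icc_self,
    fun x hx => (h x (Ico_subset_Icc_self hx)).2.mono Ico_subset_Icc_self⟩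

/-- Grönwall's inequality for `u'' = g(u)` as a first-order system. -/
theorem dist_le {K : NNReal} (hg : LipschitzWith K g) (h : IsTrajOn g c b u v)
    (h' : IsTrajOn g c b u' v') :
    ∀ x ∈ Icc c b, dist (u x, v x) (u' x, v' x) ≤
      dist (u c, v c) (u' c, v' c) * Real.exp (max 1 K * (x - c)) := by
  have hF : LipschitzWith (max 1 K) (fun y : ℝ × ℝ => (y.2, g y.1)) := by
    have := LipschitzWith.prod_snd (α := ℝ) (β := ℝ) |>.prodMk
      (hg.comp (LipschitzWith.prod_fst (α := ℝ) (β := ℝ)))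
    simpa using this
  have hd : ∀ {w w₁ : ℝ → ℝ}, IsTrajOn g c b w w₁ → ∀ t ∈ Ico c b,
      HasDerivWithinAt (fun x => (w x, w₁ x)) (w₁ t, g (w t)) (Ici t) t := by
    intro w w₁ hw t ht
    have := hw t (Ico_subset_Icc_self ht)
    exact (this.1.prodMk this.2).mono_of_mem_nhdsWithin (Icc_mem_nhdsGE_of_mem ht)
  have := dist_le_of_trajectories_ODE (v := fun _ y => (y.2, g y.1)) (fun _ => hF)
    (h.continuousOn.prodMk h.continuousOn_snd) (hd h)
    (h'.continuousOn.prodMk h'.continuousOn_snd) (hd h') le_rfl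
  simpa using this

end IsTrajOn

/-- Global solvability of the initial value problem for a bounded Lipschitz nonlinearity. -/
theorem exists_isTrajOn {g : ℝ → ℝ} {K : NNReal} {M R : ℝ} (hR : 0 ≤ R) (hg : LipschitzWith K g)
    (hM : ∀ y, |g y| ≤ M) (y₀ w₀ : ℝ) :
    ∃ u v, IsTrajOn g 0 R u v ∧ u 0 = y₀ ∧ v 0 = w₀ := by
  have hM0 : 0 ≤ M := (abs_nonneg _).trans (hM 0)
  -- A priori, `|v|` stays below `N`; cutting `v` off at this level makes the field bounded.
  set N := |w₀| + M * R with hN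
  have hN0 : 0 ≤ N := by positivity
  have hclamp : LipschitzWith 1 (fun w : ℝ => max (min w N) (-N)) :=
    (LipschitzWith.id.min_const N).max_const (-N)
  set F : ℝ × ℝ → ℝ × ℝ := fun y => (max (min y.2 N) (-N), g y.1) with hF
  have hFL : LipschitzWith (max 1 K) F := by
    have := (hclamp.comp (LipschitzWith.prod_snd (α := ℝ) (β := ℝ))).prodMk
      (hg.comp (LipschitzWith.prod_fst (α := ℝ) (β := ℝ)))
    simpa using this
  have hFb : ∀ y, ‖F y‖ ≤ max N M := by
    intro y
    rw [Prod.norm_def]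
    refine max_le_max ?_ (hM _)
    rw [Real.norm_eq_abs, abs_le]
    exact ⟨le_max_right _ _, max_le (min_le_right _ _) (by linarith)⟩
  have hPL : IsPicardLindelof (fun _ => F) (tmin := 0) (tmax := R) ⟨0, le_rfl, hR⟩ (y₀, w₀)
      (Real.toNNReal (max N M * R)) 0 (Real.toNNReal (max N M)) (max 1 K) := by
    refine .of_time_independent (fun y _ => ?_) hFL.lipschitzOnWith ?_
    · rw [Real.coe_toNNReal _ (hN0.trans (le_max_left _ _))]
      exact hFb y
    · rw [Real.coe_toNNReal _ (hN0.trans (le_max_left _ _)),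
        Real.coe_toNNReal _ (mul_nonneg (hN0.trans (le_max_left _ _)) hR)]
      simp [hR]
  obtain ⟨α, hα0, hα⟩ := hPL.exists_eq_forall_mem_Icc_hasDerivWithinAt₀
  have hv : ∀ x ∈ Icc 0 R, HasDerivWithinAt (fun x => (α x).2) (g (α x).1) (Icc 0 R) x :=
    fun x hx => ((hasFDerivAt_snd (𝕜 := ℝ) (p := α x)).comp_hasDerivWithinAt x (hα x hx))
  have hu : ∀ x ∈ Icc 0 R, HasDerivWithinAt (fun x => (α x).1) (max (min (α x).2 N) (-N))
      (Icc 0 R) x :=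
    fun x hx => ((hasFDerivAt_fst (𝕜 := ℝ) (p := α x)).comp_hasDerivWithinAt x (hα x hx))
  have hα0' : α 0 = (y₀, w₀) := hα0
  have hbound : ∀ x ∈ Icc 0 R, |(α x).2| ≤ N := by
    intro x hx
    have h1 := norm_image_sub_le_of_norm_deriv_le_segment' hv (fun y _ => hM _) x hx
    rw [hα0', sub_zero, Real.norm_eq_abs] at h1
    have h2 := abs_sub_abs_le_abs_sub (α x).2 w₀
    have h3 := mul_le_mul_of_nonneg_left hx.2 hM0
    simp only at h1
    linarith
  refine ⟨fun x => (α x).1, fun x => (α x).2, fun x hx => ⟨?_, hv x hx⟩,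
    congrArg Prod.fst hα0', congrArg Prod.snd hα0'⟩
  have h1 := abs_le.1 (hbound x hx)
  have h2 := hu x hx
  rwa [min_eq_left h1.2, max_eq_left h1.1] at h2

/-- The nonlinearity `a y ^ p - lam y` for `y ≥ 0`, extended by `0` to `y < 0`: solutions that become
negative continue as affine functions. -/
noncomputable def posNL (a p lam y : ℝ) : ℝ := max y 0 * (a * max y 0 ^ (p - 1) - lam)

section posNL

variable {a p lam : ℝ}

theorem posNL_of_nonneg {y : ℝ} (hy : 0 ≤ y) : posNL a p lam y = y * (a * y ^ (p - 1) - lam) := by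
  rw [posNL, max_eq_left hy]

theorem posNL_of_nonpos {y : ℝ} (hy : y ≤ 0) : posNL a p lam y = 0 := by
  rw [posNL, max_eq_right hy, zero_mul]

theorem exists_lipschitz_trunc (ha : 0 < a) (hp : 1 < p) (lam : ℝ) {n : ℝ} (hn : 0 ≤ n) :
    ∃ K : NNReal, LipschitzWith K (fun y => posNL a p lam (min y n)) := by
  set C := a * p * n ^ (p - 1) + |lam| with hC
  have hC0 : 0 ≤ C := by positivity
  have hL : LipschitzOnWith (Real.toNNReal C) (fun y => a * y ^ p - lam * y) (Icc 0 n) := by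
    refine (convex_Icc 0 n).lipschitzOnWith_of_nnnorm_hasDerivWithin_le
      (f' := fun y => a * (p * y ^ (p - 1)) - lam * 1) (fun y _ => ?_) fun y hy => ?_
    · exact (((Real.hasDerivAt_rpow_const (Or.inr hp.le)).const_mul a).sub
        ((hasDerivAt_id y).const_mul lam)).hasDerivWithinAt
    · rw [← NNReal.coe_le_coe, Real.coe_toNNReal _ hC0, coe_nnnorm, Real.norm_eq_abs]
      refine (abs_sub _ _).trans ?_
      rw [mul_one, abs_of_nonneg (mul_nonneg ha.le (mul_nonneg (by linarith)
        (Real.rpow_nonneg hy.1 _)))]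
      have h1 : y ^ (p - 1) ≤ n ^ (p - 1) := Real.rpow_le_rpow hy.1 hy.2 (by linarith)
      have h2 := mul_le_mul_of_nonneg_left h1 (by positivity : 0 ≤ a * p)
      linarith
  have hclamp : LipschitzWith 1 (fun y : ℝ => max (min y n) 0) :=
    (LipschitzWith.id.min_const n).max_const 0
  have hmem : ∀ y : ℝ, max (min y n) 0 ∈ Icc 0 n := fun y =>
    ⟨le_max_right _ _, max_le (min_le_right _ _) hn⟩
  refine ⟨Real.toNNReal C, ?_⟩
  have h := (hL.comp hclamp.lipschitzOnWith (s := univ) fun y _ => hmem y)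
  rw [lipschitzOnWith_univ, mul_one] at h
  convert! h using 1
  funext y
  simp only [Function.comp, posNL]
  rcases (hmem y).1.eq_or_lt with h0 | h0
  · rw [← h0, Real.zero_rpow (by linarith : p ≠ 0)]; ring
  · rw [← mul_rpow_sub_one (p := p) h0]; ring

theorem exists_bound_trunc (ha : 0 < a) (hp : 1 < p) (lam : ℝ) {n : ℝ} (hn : 0 ≤ n) :
    ∃ M, ∀ y, |posNL a p lam (min y n)| ≤ M := by
  obtain ⟨K, hK⟩ := exists_lipschitz_trunc ha hp lam hn
  refine ⟨K * n, fun y => ?_⟩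
  rcases le_or_gt y 0 with hy | hy
  · rw [posNL_of_nonpos ((min_le_left _ _).trans hy), abs_zero]; positivity
  · have := hK.dist_le_mul (min y n) 0
    rw [Real.dist_eq, Real.dist_eq, min_eq_left hn, posNL_of_nonpos le_rfl, sub_zero, sub_zero,
      min_assoc, min_self, abs_of_nonneg (le_min hy.le hn)] at this
    exact this.trans (mul_le_mul_of_nonneg_left (min_le_right _ _) K.2)

theorem exists_posNL_lower_bound (ha : 0 < a) (hp : 1 < p) (lam : ℝ) :
    ∃ C, 0 ≤ C ∧ ∀ y, -C ≤ posNL a p lam y := by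
  have h1 : Tendsto (fun y : ℝ => a * y ^ (p - 1)) atTop atTop :=
    (tendsto_rpow_atTop (by linarith : 0 < p - 1)).const_mul_atTop ha
  obtain ⟨n, hn⟩ := eventually_atTop.1 ((h1.eventually_ge_atTop lam).and (eventually_ge_atTop 0))
  obtain ⟨M, hM⟩ := exists_bound_trunc ha hp lam (hn n le_rfl).2
  refine ⟨M, (abs_nonneg _).trans (hM 0), fun y => ?_⟩
  rcases le_or_gt y n with hy | hy
  · have := hM y
    rw [min_eq_left hy] at this
    exact neg_le_of_abs_le this
  · have h2 := hn y hy.le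
    rw [posNL_of_nonneg h2.2]
    exact (neg_nonpos.2 ((abs_nonneg _).trans (hM 0))).trans
      (mul_nonneg h2.2 (sub_nonneg.2 h2.1))

theorem IsTrajOn.trunc {c b n : ℝ} {u v : ℝ → ℝ} (h : IsTrajOn (posNL a p lam) c b u v)
    (hn : ∀ x ∈ Icc c b, u x ≤ n) : IsTrajOn (fun y => posNL a p lam (min y n)) c b u v :=
  h.congr_field fun x hx => by rw [min_eq_left (hn x hx)]

theorem IsTrajOn.of_trunc {c b n : ℝ} {u v : ℝ → ℝ}
    (h : IsTrajOn (fun y => posNL a p lam (min y n)) c b u v) (hn : ∀ x ∈ Icc c b, u x ≤ n) :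
    IsTrajOn (posNL a p lam) c b u v :=
  h.congr_field fun x hx => by rw [min_eq_left (hn x hx)]

theorem IsTrajOn.eq_of_posNL (ha : 0 < a) (hp : 1 < p) {c b : ℝ} {u v u' v' : ℝ → ℝ}
    (h : IsTrajOn (posNL a p lam) c b u v) (h' : IsTrajOn (posNL a p lam) c b u' v')
    (hu : u c = u' c) (hv : v c = v' c) : ∀ x ∈ Icc c b, u x = u' x ∧ v x = v' x := by
  obtain ⟨n, hn⟩ := isCompact_Icc.exists_bound_of_continuousOn h.continuousOn
  obtain ⟨n', hn'⟩ := isCompact_Icc.exists_bound_of_continuousOn h'.continuousOn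
  obtain ⟨K, hK⟩ := exists_lipschitz_trunc ha hp lam (le_max_right (max n n') 0)
  intro x hx
  have := IsTrajOn.dist_le hK
    (h.trunc fun y hy => (le_abs_self _).trans ((hn y hy).trans
      ((le_max_left _ _).trans (le_max_left _ _))))
    (h'.trunc fun y hy => (le_abs_self _).trans ((hn' y hy).trans
      ((le_max_right _ _).trans (le_max_left _ _)))) x hx
  rw [hu, hv, dist_self, zero_mul, dist_le_zero, Prod.mk.injEq] at this
  exact this

end posNL

end LargeSol

namespace LargeSol

/-! ### Existence -/

/-- A positive supersolution on `[0, R)` that blows up at `R`, with the right sign of the boundary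
operator: `C ((R - x) (x + η)) ^ (-2 / (p - 1))` with small `η` and large `C`. -/
theorem exists_large_supersolution (B : BoundaryOp) {R a p : ℝ} (lam : ℝ) (hR : 0 < R) (ha : 0 < a)
    (hp : 1 < p) : ∃ Z Z₁ Z₂, HasDerivs R Z Z₁ Z₂ ∧ (∀ x ∈ Ico 0 R, 0 < Z x) ∧
      B.dir.1 * Z₁ 0 ≤ B.dir.2 * Z 0 ∧
      (∀ x ∈ Ioo 0 R, Z₂ x ≤ Z x * (a * Z x ^ (p - 1) - lam)) ∧ Tendsto Z (𝓝[<] R) atTop := by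
  have hp1 : 0 < p - 1 := by linarith
  set α := 2 / (p - 1) with hα
  have hα0 : 0 < α := by positivity
  set η := α * R / (α + |B.dir.2| * R) with hη
  have hη0 : 0 < η := by positivity
  have hηeq : α * (R - η) = |B.dir.2| * R * η := by
    rw [hη]; field_simp; ring
  set g : ℝ → ℝ := fun x => (R - x) * (x + η) with hg
  have hgd : ∀ x, HasDerivAt g (R - η - 2 * x) x := fun x => by
    have := ((hasDerivAt_id x).const_sub R).mul ((hasDerivAt_id x).add_const η)
    convert! this using 1
    simp only [id]; ring
  have hgd2 : ∀ x, HasDerivAt (fun x => R - η - 2 * x) (-2) x := fun x => by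
    have := ((hasDerivAt_id x).const_mul 2).const_sub (R - η)
    convert! this using 1
    ring
  have hgpos : ∀ x ∈ Ico 0 R, 0 < g x := fun x hx =>
    mul_pos (by linarith [hx.2]) (by linarith [hx.1])
  set Q := α * (α + 1) * (3 * R + η) ^ 2 + 2 * α * (R * (R + η)) + |lam| * (R * (R + η)) ^ 2
    with hQ
  have hQ0 : 0 < Q := by positivity
  set C := (Q / a) ^ (1 / (p - 1)) with hC
  have hC0 : 0 < C := by positivity
  have hCp : a * C ^ (p - 1) = Q := by
    rw [hC, ← Real.rpow_mul (by positivity), one_div_mul_cancel hp1.ne', Real.rpow_one]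
    field_simp
  refine ⟨fun x => C * g x ^ (-α),
    fun x => C * ((R - η - 2 * x) * (-α) * g x ^ (-α - 1)),
    fun x => C * ((-2) * (-α) * g x ^ (-α - 1) + (R - η - 2 * x) * (-α) *
      ((R - η - 2 * x) * (-α - 1) * g x ^ (-α - 1 - 1))),
    HasDerivs.of_hasDerivAt (fun x hx => ?_) (fun x hx => ?_), ?_, ?_, ?_, ?_⟩
  · exact ((hgd x).rpow_const (Or.inl (hgpos x hx).ne')).const_mul C
  · exact ((((hgd2 x).mul_const (-α)).mul
      ((hgd x).rpow_const (Or.inl (hgpos x hx).ne')))).const_mul C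
  · exact fun x hx => mul_pos hC0 (Real.rpow_pos_of_pos (hgpos x hx) _)
  · have h0 : 0 < g 0 := hgpos 0 ⟨le_rfl, hR⟩
    have hpow := Real.rpow_pos_of_pos h0 (-α)
    have e : g 0 ^ (-α - 1) * (R * η) = g 0 ^ (-α) := by
      have : g 0 = R * η := by simp [hg]
      rw [Real.rpow_sub_one h0.ne', this]
      field_simp
    have h1 : (R - η - 2 * 0) * (-α) * g 0 ^ (-α - 1) = -|B.dir.2| * g 0 ^ (-α) := by
      rw [← e]; linear_combination (-g 0 ^ (-α - 1)) * hηeq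
    change B.dir.1 * (C * ((R - η - 2 * 0) * (-α) * g 0 ^ (-α - 1))) ≤ B.dir.2 * (C * g 0 ^ (-α))
    rw [h1]
    by_cases hB : B = .dirichlet
    · subst hB
      simp only [BoundaryOp.dir, zero_mul, one_mul]
      positivity
    · rw [BoundaryOp.dir_fst_eq_one hB, one_mul]
      have h2 := mul_le_mul_of_nonneg_right (neg_abs_le B.dir.2) (mul_pos hC0 hpow).le
      linarith
  · intro x hx
    have hgx := hgpos x (Ioo_subset_Ico_self hx)
    have hgle : g x ≤ R * (R + η) :=
      mul_le_mul (by linarith [hx.1]) (by linarith [hx.2]) (by linarith [hx.1]) hR.le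
    have e1 : g x ^ (-α - 1) = g x ^ (-α - 1 - 1) * g x := by
      rw [Real.rpow_sub_one hgx.ne' (-α - 1)]; field_simp
    have e2 : g x ^ (-α) = g x ^ (-α - 1 - 1) * g x ^ 2 := by
      rw [Real.rpow_sub_one hgx.ne' (-α - 1), Real.rpow_sub_one hgx.ne' (-α)]; field_simp
    have e3 : (C * g x ^ (-α)) ^ (p - 1) * g x ^ 2 = C ^ (p - 1) := by
      rw [Real.mul_rpow hC0.le (Real.rpow_nonneg hgx.le _), ← Real.rpow_mul hgx.le, mul_assoc,
        ← Real.rpow_natCast, ← Real.rpow_add hgx]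
      have : -α * (p - 1) + (2 : ℕ) = 0 := by rw [hα]; field_simp; norm_num
      rw [this, Real.rpow_zero, mul_one]
    have hd : (R - η - 2 * x) ^ 2 ≤ (3 * R + η) ^ 2 :=
      sq_le_sq' (by linarith [hx.2]) (by linarith [hx.1])
    have hg2 : g x ^ 2 ≤ (R * (R + η)) ^ 2 := pow_le_pow_left₀ hgx.le hgle 2
    have hlam : lam * g x ^ 2 ≤ |lam| * (R * (R + η)) ^ 2 :=
      (mul_le_mul_of_nonneg_right (le_abs_self lam) (sq_nonneg _)).trans
        (mul_le_mul_of_nonneg_left hg2 (abs_nonneg _))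
    have hmain : α * (α + 1) * (R - η - 2 * x) ^ 2 + 2 * α * g x ≤ Q - lam * g x ^ 2 := by
      have h1 := mul_le_mul_of_nonneg_left hd (by positivity : 0 ≤ α * (α + 1))
      have h2 := mul_le_mul_of_nonneg_left hgle (by positivity : 0 ≤ 2 * α)
      linarith
    have hpow : 0 ≤ C * g x ^ (-α - 1 - 1) := by positivity
    calc _ = C * g x ^ (-α - 1 - 1) *
          (α * (α + 1) * (R - η - 2 * x) ^ 2 + 2 * α * g x) := by beta_reduce; rw [e1]; ring
      _ ≤ C * g x ^ (-α - 1 - 1) * (Q - lam * g x ^ 2) := mul_le_mul_of_nonneg_left hmain hpow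
      _ = C * (g x ^ (-α - 1 - 1) * g x ^ 2) * (a * (C * g x ^ (-α)) ^ (p - 1) - lam) := by
          rw [← hCp, ← e3]; ring
      _ = _ := by rw [← e2]
  · have hgR : Tendsto g (𝓝[<] R) (𝓝[>] 0) := by
      refine tendsto_nhdsWithin_iff.2 ⟨?_, ?_⟩
      · have : Tendsto g (𝓝[<] R) (𝓝 (g R)) := (hgd R).continuousAt.continuousWithinAt
        simpa [hg] using this
      · filter_upwards [Ico_mem_nhdsLT hR] with x hx using hgpos x hx
    exact ((tendsto_rpow_neg_nhdsGT_zero (neg_neg_iff_pos.2 hα0)).comp hgR).const_mul_atTop hC0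

theorem le_supersolution {B : BoundaryOp} {R a p lam : ℝ} (hR : 0 < R) (ha : 0 < a) (hp : 1 < p)
    {Z Z₁ Z₂ : ℝ → ℝ} (hZ : HasDerivs R Z Z₁ Z₂) (hpos : ∀ x ∈ Ico 0 R, 0 < Z x)
    (hb : B.dir.1 * Z₁ 0 ≤ B.dir.2 * Z 0)
    (hsup : ∀ x ∈ Ioo 0 R, Z₂ x ≤ Z x * (a * Z x ^ (p - 1) - lam))
    (hlim : Tendsto Z (𝓝[<] R) atTop) {u v : ℝ → ℝ} {s : ℝ} (hs : 0 ≤ s)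
    (h : IsTrajOn (posNL a p lam) 0 R u v) (hu : u 0 = s * B.dir.1) (hv : v 0 = s * B.dir.2) :
    ∀ x ∈ Ico 0 R, u x ≤ Z x := by
  obtain ⟨M, hM⟩ := isCompact_Icc.exists_bound_of_continuousOn h.continuousOn
  refine le_of_le_Ioo hR (h.continuousOn.mono Ico_subset_Icc_self) hZ.continuousOn ?_
  refine h.hasDerivs.le_of_sub_super ha hp hZ (fun x hx => hpos x (Ioo_subset_Ico_self hx)) ?_
    (fun x hx hlt => ?_) (fun x hx _ => hsup x hx) fun ε hε => ?_
  · rw [hu, hv]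
    linarith [mul_le_mul_of_nonneg_left hb hs]
  · rw [posNL_of_nonneg ((hpos x (Ioo_subset_Ico_self hx)).trans hlt).le]
  · filter_upwards [hlim.eventually_ge_atTop M, Ioo_mem_nhdsLT hR] with x h1 hx
    have h2 := (le_abs_self _).trans (hM x (Ioo_subset_Icc_self hx))
    have h3 := mul_pos hε (hpos x (Ioo_subset_Ico_self hx))
    linarith

/-- A solution on `[0, R)` that is unbounded above tends to `+∞` at `R`, since adding a quadratic
polynomial makes it convex. -/
theorem tendsto_atTop_of_unbounded {R C : ℝ} (hR : 0 < R) {u u₁ u₂ : ℝ → ℝ}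
    (h : HasDerivs R u u₁ u₂) (hC : ∀ x ∈ Ioo 0 R, -C ≤ u₂ x) (hC0 : 0 ≤ C)
    (hunb : ∀ M, ∃ x ∈ Ico 0 R, M < u x) : Tendsto u (𝓝[<] R) atTop := by
  have hd : ∀ x, HasDerivAt (fun x : ℝ => C / 2 * x ^ 2) (C * x) x := fun x => by
    have := (hasDerivAt_pow 2 x).const_mul (C / 2)
    convert! this using 1
    push_cast; ring
  have hd2 : ∀ x, HasDerivAt (fun x : ℝ => C * x) C x := fun x => by
    simpa using (hasDerivAt_id x).const_mul C
  have hconv : ConvexOn ℝ (Ico 0 R) (fun x => u x + C / 2 * x ^ 2) := by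
    refine convexOn_of_hasDerivWithinAt2_nonneg (convex_Ico 0 R)
      (h.continuousOn.add (by fun_prop)) (f' := fun x => u₁ x + C * x) (f'' := fun x => u₂ x + C)
      (fun x hx => ?_) (fun x hx => ?_) fun x hx => ?_ <;> rw [interior_Ico] at hx
    · exact ((h.hasDerivAt hx).add (hd x)).hasDerivWithinAt
    · exact ((h.hasDerivAt_fst hx).add (hd2 x)).hasDerivWithinAt
    · linarith [hC x hx]
  refine tendsto_atTop.2 fun T => ?_
  obtain ⟨y, hy, hyu⟩ := hunb (max (u 0) (T + C / 2 * R ^ 2))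
  filter_upwards [Ioo_mem_nhdsLT hy.2] with x hx
  have h1 := hconv.le_max_of_mem_Icc ⟨le_rfl, hR⟩ ⟨hy.1.trans hx.1.le, hx.2⟩ ⟨hy.1, hx.1.le⟩
  have h2 : 0 ≤ C / 2 * y ^ 2 := by positivity
  have h3 : C / 2 * x ^ 2 ≤ C / 2 * R ^ 2 := mul_le_mul_of_nonneg_left
    (pow_le_pow_left₀ (hy.1.trans hx.1.le) hx.2.le 2) (by positivity)
  rcases le_max_iff.1 h1 with h4 | h4
  · have := (le_max_left _ _).trans_lt hyu
    simp only [ne_eq, OfNat.ofNat_ne_zero, not_false_eq_true, zero_pow, mul_zero, add_zero] at h4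
    linarith
  · have := (le_max_right _ _).trans_lt hyu
    linarith

/-- A solution that blows up at `R` is positive: from a point where it is nonpositive and
nonincreasing it would continue as an affine function. -/
theorem pos_of_tendsto_atTop {R a p lam : ℝ} (ha : 0 < a) (hp : 1 < p)
    {u v : ℝ → ℝ} (h : ∀ b < R, IsTrajOn (posNL a p lam) 0 b u v) (h0 : 0 ≤ u 0)
    (hlim : Tendsto u (𝓝[<] R) atTop) : ∀ x ∈ Ioo 0 R, 0 < u x := by
  intro y hy
  by_contra! huy
  obtain ⟨m, hm, hum, hmin⟩ : ∃ m ∈ Ioc 0 y, u m ≤ 0 ∧ ∀ z ∈ Icc 0 y, u m ≤ u z := by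
    obtain ⟨m, hm, hmin⟩ := isCompact_Icc.exists_isMinOn (nonempty_Icc.2 hy.1.le)
      (h y hy.2).continuousOn
    rcases hm.1.eq_or_lt with hm0 | hm0
    · refine ⟨y, ⟨hy.1, le_rfl⟩, huy, fun z hz => ?_⟩
      have : u m ≤ u z := hmin hz
      rw [← hm0] at this
      linarith
    · exact ⟨m, ⟨hm0, hm.2⟩, (hmin (right_mem_Icc.2 hy.1.le) : u m ≤ u y).trans huy,
        fun z hz => hmin hz⟩
  have hvm : v m ≤ 0 := by
    have hd := ((h y hy.2) m ⟨hm.1.le, hm.2⟩).1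
    have hd' : HasDerivWithinAt u (v m) (Iio m) m :=
      hd.mono_of_mem_nhdsWithin (mem_of_superset (Ioo_mem_nhdsLT hm.1)
        fun z hz => ⟨hz.1.le, hz.2.le.trans hm.2⟩)
    refine le_of_tendsto ((hasDerivWithinAt_iff_tendsto_slope' self_notMem_Iio).1 hd') ?_
    filter_upwards [Ioo_mem_nhdsLT hm.1] with z hz
    rw [slope_def_field]
    exact div_nonpos_of_nonneg_of_nonpos
      (sub_nonneg.2 (hmin z ⟨hz.1.le, hz.2.le.trans hm.2⟩)) (sub_nonpos.2 hz.2.le)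
  have hmR : m < R := hm.2.trans_lt hy.2
  have haff : ∀ x ∈ Ioo m R, u x ≤ 0 := by
    intro x hx
    have hle : ∀ z ∈ Icc m x, u m + v m * (z - m) ≤ 0 := fun z hz =>
      add_nonpos hum (mul_nonpos_of_nonpos_of_nonneg hvm (sub_nonneg.2 hz.1))
    have htraj : IsTrajOn (posNL a p lam) m x (fun z => u m + v m * (z - m)) (fun _ => v m) := by
      intro z hz
      refine ⟨?_, ?_⟩
      · have := (((hasDerivAt_id z).sub_const m).const_mul (v m)).const_add (u m)
        rw [mul_one] at this
        exact this.hasDerivWithinAt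
      · rw [posNL_of_nonpos (hle z hz)]
        exact hasDerivWithinAt_const _ _ _
    have := (((h x hx.2).mono hm.1.le le_rfl).eq_of_posNL ha hp htraj (by simp) rfl x
      (right_mem_Icc.2 hx.1.le)).1
    rw [this]
    exact hle x (right_mem_Icc.2 hx.1.le)
  obtain ⟨x, hx1, hx2⟩ := ((hlim.eventually_gt_atTop 0).and (Ioo_mem_nhdsLT hmR)).exists
  exact absurd hx1 (not_lt.2 (haff x hx2))

/-- Existence by shooting: the supremum of the initial data whose solution exists on all of `[0, R]`
gives a solution on `[0, R)` that cannot be continued to `R`. -/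
theorem exists_largeSolution (B : BoundaryOp) {R a p : ℝ} (lam : ℝ) (hR : 0 < R) (ha : 0 < a)
    (hp : 1 < p) : ∃ u v, LargeSolution B R a p lam u v := by
  obtain ⟨Z, Z₁, Z₂, hZ, hZpos, hZb, hZs, hZlim⟩ := exists_large_supersolution B lam hR ha hp
  set A : Set ℝ := {s | 0 ≤ s ∧ ∃ u v, IsTrajOn (posNL a p lam) 0 R u v ∧ u 0 = s * B.dir.1 ∧
    v 0 = s * B.dir.2} with hA
  have hA0 : (0 : ℝ) ∈ A := by
    refine ⟨le_rfl, fun _ => 0, fun _ => 0, fun x _ => ⟨hasDerivWithinAt_const _ _ _, ?_⟩,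
      by simp, by simp⟩
    rw [posNL_of_nonpos le_rfl]
    exact hasDerivWithinAt_const _ _ _
  have hAZ : ∀ {s : ℝ} {u v : ℝ → ℝ}, 0 ≤ s → IsTrajOn (posNL a p lam) 0 R u v →
      u 0 = s * B.dir.1 → v 0 = s * B.dir.2 → ∀ x ∈ Ico 0 R, u x ≤ Z x := fun hs h hu hv =>
    le_supersolution hR ha hp hZ hZpos hZb hZs hZlim hs h hu hv
  obtain ⟨C, hC0, hC⟩ := exists_posNL_lower_bound ha hp lam
  have hbdd : BddAbove A := by
    by_cases hB : B = .dirichlet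
    · -- The slope at `0` is bounded since `u'' ≥ -C` and `u (R / 2) ≤ Z (R / 2)`.
      refine ⟨Z (R / 2) / (R / 2) + C * R, ?_⟩
      rintro s ⟨hs, u, v, h, hu, hv⟩
      rw [hB] at hu hv
      simp only [BoundaryOp.dir, mul_zero, mul_one] at hu hv
      have hD := h.hasDerivs
      have hv' : ∀ x ∈ Ioo 0 (R / 2), s - C * R ≤ v x := by
        intro x hx
        have hmono : MonotoneOn (fun x => v x + C * x) (Icc 0 x) := by
          refine monotoneOn_of_hasDerivWithinAt_nonneg (convex_Icc 0 x)
            ((h.continuousOn_snd.mono (Icc_subset_Icc_right (by linarith [hx.2]))).add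
              (by fun_prop)) (f' := fun x => posNL a p lam (u x) + C * 1) (fun y hy => ?_)
            fun y _ => by linarith [hC (u y)]
          rw [interior_Icc] at hy
          exact ((hD.hasDerivAt_fst ⟨hy.1, by linarith [hy.2, hx.2]⟩).add
            ((hasDerivAt_id y).const_mul C)).hasDerivWithinAt
        have h1 := hmono (left_mem_Icc.2 hx.1.le) (right_mem_Icc.2 hx.1.le) hx.1.le
        simp only [mul_zero, add_zero, hv] at h1
        have h2 := mul_le_mul_of_nonneg_left (by linarith [hx.2] : x ≤ R) hC0
        linarith
      obtain ⟨ξ, hξ, hslope⟩ := exists_hasDerivAt_eq_slope u v (half_pos hR)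
        (h.continuousOn.mono (Icc_subset_Icc_right (by linarith)))
        (fun x hx => hD.hasDerivAt ⟨hx.1, by linarith [hx.2]⟩)
      have h3 := hv' ξ hξ
      rw [hslope, hu, sub_zero, sub_zero] at h3
      have h4 : u (R / 2) / (R / 2) ≤ Z (R / 2) / (R / 2) :=
        div_le_div_of_nonneg_right (hAZ hs h (by rw [hB]; simp [BoundaryOp.dir, hu])
          (by rw [hB]; simp [BoundaryOp.dir, hv]) _ ⟨by linarith, by linarith⟩) (by linarith)
      linarith
    · refine ⟨Z 0, ?_⟩
      rintro s ⟨hs, u, v, h, hu, hv⟩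
      have := hAZ hs h hu hv 0 ⟨le_rfl, hR⟩
      rwa [hu, BoundaryOp.dir_fst_eq_one hB, mul_one] at this
  set σ := sSup A with hσ
  have hσ0 : 0 ≤ σ := le_csSup hbdd hA0
  have hσcl : σ ∈ closure A := csSup_mem_closure ⟨0, hA0⟩ hbdd
  -- `U n s` solves the problem truncated at the level `n`; it depends continuously on `s`.
  have hU : ∀ n s : ℝ, ∃ u v, 0 ≤ n → IsTrajOn (fun y => posNL a p lam (min y n)) 0 R u v ∧
      u 0 = s * B.dir.1 ∧ v 0 = s * B.dir.2 := by
    intro n s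
    by_cases hn : 0 ≤ n
    · obtain ⟨K, hK⟩ := exists_lipschitz_trunc ha hp lam hn
      obtain ⟨M, hM⟩ := exists_bound_trunc ha hp lam hn
      obtain ⟨u, v, h⟩ := exists_isTrajOn hR.le hK hM (s * B.dir.1) (s * B.dir.2)
      exact ⟨u, v, fun _ => h⟩
    · exact ⟨0, 0, fun h => absurd h hn⟩
  choose U V hUV using hU
  have hUcont : ∀ n, 0 ≤ n → ∃ D, 0 < D ∧ ∀ s s', ∀ x ∈ Icc 0 R,
      |U n s x - U n s' x| ≤ D * |s - s'| := by
    intro n hn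
    obtain ⟨K, hK⟩ := exists_lipschitz_trunc ha hp lam hn
    refine ⟨‖B.dir‖ * Real.exp (max 1 K * R) + 1, by positivity, fun s s' x hx => ?_⟩
    obtain ⟨h1, h2, h3⟩ := hUV n s hn
    obtain ⟨h1', h2', h3'⟩ := hUV n s' hn
    have h4 := IsTrajOn.dist_le hK h1 h1' x hx
    have e : dist (U n s 0, V n s 0) (U n s' 0, V n s' 0) = |s - s'| * ‖B.dir‖ := by
      rw [h2, h3, h2', h3', ← Real.norm_eq_abs, ← norm_smul, sub_smul, dist_eq_norm]
      rfl
    rw [e, sub_zero] at h4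
    have h5 : |U n s x - U n s' x| ≤ _ := (le_max_left _ _).trans h4
    have h6 : Real.exp ((max 1 K : NNReal) * x) ≤ Real.exp ((max 1 K : NNReal) * R) :=
      Real.exp_le_exp.2 (mul_le_mul_of_nonneg_left hx.2 (NNReal.coe_nonneg _))
    have h7 := mul_le_mul_of_nonneg_left h6
      (mul_nonneg (abs_nonneg (s - s')) (norm_nonneg B.dir))
    have h8 := abs_nonneg (s - s')
    linarith
  have hM : ∀ b, ∃ n, 0 ≤ n ∧ (b < R → ∀ x ∈ Icc 0 b, Z x ≤ n) := by
    intro b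
    by_cases hb : b < R
    · obtain ⟨n, hn⟩ := isCompact_Icc.exists_bound_of_continuousOn
        (hZ.continuousOn.mono fun x (hx : x ∈ Icc 0 b) => ⟨hx.1, hx.2.trans_lt hb⟩)
      exact ⟨max n 0, le_max_right _ _, fun _ x hx =>
        (le_abs_self _).trans ((hn x hx).trans (le_max_left _ _))⟩
    · exact ⟨0, le_rfl, fun h => absurd h hb⟩
  choose M hM0 hM using hM
  have hUZ : ∀ b < R, ∀ x ∈ Icc 0 b, U (M b) σ x ≤ Z x := by
    intro b hb x hx
    have hxR : x ∈ Ico 0 R := ⟨hx.1, hx.2.trans_lt hb⟩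
    have hcont : Continuous fun s => U (M b) s x := by
      obtain ⟨D, hD, hlip⟩ := hUcont (M b) (hM0 b)
      exact (LipschitzWith.of_dist_le_mul (K := Real.toNNReal D) fun s s' => by
        rw [Real.coe_toNNReal _ hD.le]
        exact hlip s s' x (Ico_subset_Icc_self hxR)).continuous
    have hsub : A ⊆ {s | U (M b) s x ≤ Z x} := by
      rintro s ⟨hs, u, v, h, hu, hv⟩
      obtain ⟨K, hK⟩ := exists_lipschitz_trunc ha hp lam (hM0 b)
      obtain ⟨h1, h2, h3⟩ := hUV (M b) s (hM0 b)
      have huZ := hAZ hs h hu hv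
      have h4 := IsTrajOn.dist_le hK (h1.mono le_rfl hb.le)
        ((h.mono le_rfl hb.le).trunc fun y hy =>
          (huZ y ⟨hy.1, hy.2.trans_lt hb⟩).trans (hM b hb y hy)) x hx
      rw [h2, h3, hu, hv, dist_self, zero_mul, dist_le_zero, Prod.mk.injEq] at h4
      exact h4.1.trans_le (huZ x hxR)
    exact (isClosed_le hcont continuous_const).closure_subset_iff.2 hsub hσcl
  have hUtraj : ∀ b < R, IsTrajOn (posNL a p lam) 0 b (U (M b) σ) (V (M b) σ) := fun b hb =>
    (((hUV (M b) σ (hM0 b)).1).mono le_rfl hb.le).of_trunc fun x hx =>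
      (hUZ b hb x hx).trans (hM b hb x hx)
  set u : ℝ → ℝ := fun x => U (M x) σ x with hu
  set v : ℝ → ℝ := fun x => V (M x) σ x with hv
  have huv : ∀ b < R, ∀ x ∈ Icc 0 b, u x = U (M b) σ x ∧ v x = V (M b) σ x := by
    intro b hb x hx
    obtain ⟨-, h2, h3⟩ := hUV (M x) σ (hM0 x)
    obtain ⟨-, h2', h3'⟩ := hUV (M b) σ (hM0 b)
    exact (hUtraj x (hx.2.trans_lt hb)).eq_of_posNL ha hp ((hUtraj b hb).mono le_rfl hx.2)
      (h2.trans h2'.symm) (h3.trans h3'.symm) x (right_mem_Icc.2 hx.1)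
  have htraj : ∀ b < R, IsTrajOn (posNL a p lam) 0 b u v := by
    intro b hb x hx
    have h1 := hUtraj b hb x hx
    refine ⟨?_, ?_⟩
    · rw [(huv b hb x hx).2]
      exact h1.1.congr (fun y hy => (huv b hb y hy).1) (huv b hb x hx).1
    · rw [(huv b hb x hx).1]
      exact h1.2.congr (fun y hy => (huv b hb y hy).2) (huv b hb x hx).2
  have hu0 : u 0 = σ * B.dir.1 := (hUV (M 0) σ (hM0 0)).2.1
  have hv0 : v 0 = σ * B.dir.2 := (hUV (M 0) σ (hM0 0)).2.2
  have hderivs : HasDerivs R u v (fun x => posNL a p lam (u x)) := by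
    have hnhds : ∀ x ∈ Ico 0 R, ∃ b < R, x ∈ Icc 0 b ∧ Icc 0 b ∈ 𝓝[Ico 0 R] x := by
      intro x hx
      obtain ⟨b, hxb, hbR⟩ := exists_between hx.2
      refine ⟨b, hbR, ⟨hx.1, hxb.le⟩, ?_⟩
      rw [mem_nhdsWithin]
      exact ⟨Iio b, isOpen_Iio, hxb, fun y hy => ⟨hy.2.1, hy.1.le⟩⟩
    refine ⟨fun x hx => ?_, fun x hx => ?_⟩ <;> obtain ⟨b, hb, hxb, hmem⟩ := hnhds x hx
    · exact (htraj b hb x hxb).1.mono_of_mem_nhdsWithin hmem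
    · exact (htraj b hb x hxb).2.mono_of_mem_nhdsWithin hmem
  have hunb : ∀ n, ∃ x ∈ Ico 0 R, n < u x := by
    -- Otherwise `u` extends to `[0, R]`, and so do the solutions with slightly larger data.
    by_contra! hbound
    obtain ⟨n₀, hn₀⟩ := hbound
    set n := max n₀ 0 + 1 with hn
    have hn0 : 0 ≤ n := by positivity
    obtain ⟨K, hK⟩ := exists_lipschitz_trunc ha hp lam hn0
    obtain ⟨D, hD, hlip⟩ := hUcont n hn0
    have hle : ∀ x ∈ Ico 0 R, U n σ x ≤ n - 1 := by
      intro x hx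
      obtain ⟨h1, h2, h3⟩ := hUV n σ hn0
      have hun : ∀ y ∈ Icc 0 x, u y ≤ n - 1 := fun y hy => by
        have := (hn₀ y ⟨hy.1, hy.2.trans_lt hx.2⟩).trans (le_max_left n₀ 0)
        linarith
      have h4 := IsTrajOn.dist_le hK (h1.mono le_rfl hx.2.le)
        ((htraj x hx.2).trunc fun y hy => (hun y hy).trans (by linarith)) x
        (right_mem_Icc.2 hx.1)
      rw [h2, h3, hu0, hv0, dist_self, zero_mul, dist_le_zero, Prod.mk.injEq] at h4
      exact h4.1.trans_le (hun x (right_mem_Icc.2 hx.1))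
    have hle' : ∀ x ∈ Icc 0 R, U n σ x ≤ n - 1 := by
      intro x hx
      refine ContinuousWithinAt.closure_le (s := Ico 0 R) (by rwa [closure_Ico hR.ne])
        (((hUV n σ hn0).1.continuousOn x hx).mono Ico_subset_Icc_self)
        continuousWithinAt_const hle
    have hmem : σ + D⁻¹ ∈ A := by
      refine ⟨by positivity, U n (σ + D⁻¹), V n (σ + D⁻¹), ?_, (hUV n _ hn0).2.1,
        (hUV n _ hn0).2.2⟩
      refine (hUV n _ hn0).1.of_trunc fun x hx => ?_
      have h1 := (abs_le.1 (hlip (σ + D⁻¹) σ x hx)).2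
      rw [add_sub_cancel_left, abs_of_pos (inv_pos.2 hD), mul_inv_cancel₀ hD.ne'] at h1
      linarith [hle' x hx]
    have := le_csSup hbdd hmem
    have := inv_pos.2 hD
    linarith
  have hlim := tendsto_atTop_of_unbounded hR hderivs (fun x _ => hC _) hC0 hunb
  have hu00 : 0 ≤ u 0 := by
    rw [hu0]
    refine mul_nonneg hσ0 ?_
    cases B <;> simp [BoundaryOp.dir]
  have hpos := pos_of_tendsto_atTop ha hp htraj hu00 hlim
  have hnn := nonneg_of_nonneg_Ioo hR hderivs.continuousOn fun x hx => (hpos x hx).le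
  refine ⟨u, v, ⟨hderivs.fst, fun x hx => ?_⟩, ?_, hlim, hpos⟩
  · have := hderivs.snd x hx
    rwa [posNL_of_nonneg (hnn x hx)] at this
  · rw [hu0, hv0]; ring

end LargeSol

namespace LargeSol

/-! ### Limits on compact sets -/

namespace LargeSolution

variable {B : BoundaryOp} {R a p : ℝ} {L V : ℝ → ℝ → ℝ}

theorem tendsToInfty_of_ne_dirichlet (hL : ∀ mu, LargeSolution B R a p mu (L mu) (V mu))
    (hB : B ≠ .dirichlet) (hR : 0 < R) (ha : 0 < a) (hp : 1 < p) :
    TendsToInftyOnCompacts L (Ico 0 R) := by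
  intro K _ hKR M
  obtain ⟨lam₀, h⟩ := exists_forall_le_of_ne_dirichlet hB hR ha hp
    (by positivity : 0 < |M| + 1)
  filter_upwards [eventually_ge_atTop lam₀] with lam hlam x hx
  linarith [h lam hlam _ _ (hL lam) x (hKR hx), le_abs_self M]

theorem tendsToInfty_of_dirichlet (hL : ∀ mu, LargeSolution .dirichlet R a p mu (L mu) (V mu))
    (hR : 0 < R) (ha : 0 < a) (hp : 1 < p) : TendsToInftyOnCompacts L (Ioo 0 R) := by
  intro K hK hKR M
  rcases K.eq_empty_or_nonempty with rfl | hne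
  · simp
  obtain ⟨y, hy, hmin⟩ := hK.exists_isMinOn hne
    (f := fun x => Real.sin (Real.pi / R * x)) (by fun_prop)
  have hm : 0 < Real.sin (Real.pi / R * y) := by
    have hy' := hKR hy
    refine Real.sin_pos_of_pos_of_lt_pi (mul_pos (div_pos Real.pi_pos hR) hy'.1) ?_
    rw [div_mul_eq_mul_div, div_lt_iff₀ hR]
    exact mul_lt_mul_of_pos_left hy'.2 Real.pi_pos
  have hM : 0 < (|M| + 1) / Real.sin (Real.pi / R * y) := by positivity
  obtain ⟨lam₀, h⟩ := exists_forall_sin_le hR ha hp hM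
  filter_upwards [eventually_ge_atTop lam₀] with lam hlam x hx
  have h1 := mul_le_mul_of_nonneg_left
    (hmin hx : Real.sin (Real.pi / R * y) ≤ Real.sin (Real.pi / R * x)) hM.le
  rw [div_mul_cancel₀ _ hm.ne'] at h1
  linarith [h lam hlam _ _ (hL lam) x (hKR hx), le_abs_self M]

theorem tendstoUniformlyOn_zero (hL : ∀ mu, LargeSolution B R a p mu (L mu) (V mu))
    (hR : 0 < R) (ha : 0 < a) (hp : 1 < p) {K : Set ℝ} (hK : IsCompact K) (hKR : K ⊆ Ico 0 R) :
    TendstoUniformlyOn L (fun _ => 0) atBot K := by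
  obtain ⟨b, hb0, hbR, hKb⟩ : ∃ b, 0 < b ∧ b < R ∧ K ⊆ Ico 0 b := by
    rcases K.eq_empty_or_nonempty with rfl | hne
    · exact ⟨R / 2, by linarith, by linarith, empty_subset _⟩
    · obtain ⟨k, hk, hmax⟩ := hK.exists_isGreatest hne
      obtain ⟨b, hkb, hbR⟩ := exists_between (hKR hk).2
      exact ⟨b, (hKR hk).1.trans_lt hkb, hbR,
        fun x hx => ⟨(hKR hx).1, (hmax hx).trans_lt hkb⟩⟩
  obtain ⟨c, hbc, hcR⟩ := exists_between hbR
  obtain ⟨M, hM⟩ := isCompact_Icc.exists_bound_of_continuousOn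
    ((hL 0).derivs.continuousOn.mono fun x (hx : x ∈ Icc 0 c) => ⟨hx.1, hx.2.trans_lt hcR⟩)
  rw [Metric.tendstoUniformlyOn_iff]
  intro ε hε
  obtain ⟨lam₀, h⟩ := exists_forall_le_of_bounded B hR ha hp
    (by positivity : 0 < |M| + 1) hb0 hbc hcR (by positivity : 0 < ε / 4)
  filter_upwards [eventually_le_atBot lam₀, eventually_le_atBot 0] with lam hlam hlam0 x hx
  have hbound : ∀ y ∈ Ioo 0 c, L lam y ≤ |M| + 1 := fun y hy => by
    have h1 := (hL lam).le_of_le (hL 0) hR ha hp hlam0 y ⟨hy.1.le, hy.2.trans hcR⟩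
    have h2 := (le_abs_self _).trans (hM y ⟨hy.1.le, hy.2.le⟩)
    linarith [le_abs_self M]
  have h1 := le_of_le_Ioo hb0
    ((hL lam).derivs.continuousOn.mono (Ico_subset_Ico_right hbR.le)) continuousOn_const
    (fun y hy => h lam hlam _ _ (hL lam) hbound y ⟨hy.1, hy.2.le⟩) x (hKb hx)
  rw [dist_comm, Real.dist_eq, sub_zero, abs_of_nonneg ((hL lam).nonneg hR x (hKR hx))]
  linarith

end LargeSolution

end LargeSol

theorem theorem1p1 (B : LargeSol.BoundaryOp) (R a p : ℝ) (hR : 0 < R) (ha : 0 < a) (hp : 1 < p) :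
    ∃ L : ℝ → ℝ → ℝ,
      -- existence and uniqueness of the positive solution
      (∀ lam : ℝ, LargeSol.IsPositiveSolution B R a p lam (L lam) ∧
        ∀ u : ℝ → ℝ, LargeSol.IsPositiveSolution B R a p lam u → EqOn u (L lam) (Ico 0 R)) ∧
      -- differentiability in the parameter
      LargeSol.DifferentiableIntoC R L ∧
      -- strict pointwise monotonicity in the parameter
      (∀ lam₁ lam₂ : ℝ, lam₁ < lam₂ →
        (∀ x ∈ Ioo 0 R, L lam₁ x < L lam₂ x) ∧
        (B ≠ .dirichlet → L lam₁ 0 < L lam₂ 0) ∧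
        (B = .dirichlet →
          derivWithin (L lam₁) (Ico 0 R) 0 < derivWithin (L lam₂) (Ico 0 R) 0)) ∧
      -- behavior at `+∞`
      (B ≠ .dirichlet → LargeSol.TendsToInftyOnCompacts L (Ico 0 R)) ∧
      (B = .dirichlet →
        LargeSol.TendsToInftyOnCompacts L (Ioo 0 R) ∧ ∀ lam : ℝ, L lam 0 = 0) ∧
      -- behavior at `-∞`
      (∀ K : Set ℝ, IsCompact K → K ⊆ Ico 0 R →
        TendstoUniformlyOn L (fun _ => 0) atBot K) := by
  choose L V hL using fun lam => LargeSol.exists_largeSolution B (p := p) lam hR ha hp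
  have h00 : (0 : ℝ) ∈ Ico 0 R := ⟨le_rfl, hR⟩
  have hinit : ∀ lam₁ lam₂ : ℝ, lam₁ < lam₂ → ∃ t s, t < s ∧
      L lam₁ 0 = t * B.dir.1 ∧ V lam₁ 0 = t * B.dir.2 ∧
      L lam₂ 0 = s * B.dir.1 ∧ V lam₂ 0 = s * B.dir.2 := by
    intro lam₁ lam₂ hlt
    obtain ⟨t, ht, hu, hv⟩ := (hL lam₁).exists_initial hR hp
    obtain ⟨s, -, hu', hv'⟩ := (hL lam₂).exists_initial hR hp
    exact ⟨t, s, (hL lam₁).initial_lt_of_lt (hL lam₂) hR ha hp hlt ht hu hv hu' hv',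
      hu, hv, hu', hv'⟩
  refine ⟨L, fun lam => ⟨(hL lam).isPositiveSolution hR hp, fun u hu x hx => ?_⟩,
    LargeSol.LargeSolution.differentiableIntoC hL hR ha hp, fun lam₁ lam₂ hlt => ⟨?_, ?_, ?_⟩,
    fun hB => LargeSol.LargeSolution.tendsToInfty_of_ne_dirichlet hL hB hR ha hp, ?_,
    fun K hK hKR => LargeSol.LargeSolution.tendstoUniformlyOn_zero hL hR ha hp hK hKR⟩
  · have hu' := hu.largeSolution hR
    exact le_antisymm (hu'.le_of_le (hL lam) hR ha hp le_rfl x hx)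
      ((hL lam).le_of_le hu' hR ha hp le_rfl x hx)
  · exact (hL lam₁).lt_of_lt (hL lam₂) hR ha hp hlt
  · intro hB
    obtain ⟨t, s, hts, hu, -, hu', -⟩ := hinit lam₁ lam₂ hlt
    rwa [hu, hu', LargeSol.BoundaryOp.dir_fst_eq_one hB, mul_one, mul_one]
  · rintro rfl
    obtain ⟨t, s, hts, -, hv, -, hv'⟩ := hinit lam₁ lam₂ hlt
    have huniq := uniqueDiffOn_Ico (0 : ℝ) R 0 h00
    rw [((hL lam₁).derivs.fst 0 h00).derivWithin huniq,
      ((hL lam₂).derivs.fst 0 h00).derivWithin huniq, hv, hv']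
    simpa [LargeSol.BoundaryOp.dir] using hts
  · rintro rfl
    refine ⟨LargeSol.LargeSolution.tendsToInfty_of_dirichlet hL hR ha hp, fun lam => ?_⟩
    obtain ⟨t, -, hu, -⟩ := (hL lam).exists_initial hR hp
    rw [hu]
    simp [LargeSol.BoundaryOp.dir]
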